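/- **Model.** A battery has capacity $E>0$, control interval $\tau>0$, charging and discharging efficiencies $\eta_c,\eta_d>0$, power rating $P$, cell replacement price $B>0$, penalty prices $\theta,\pi\ge 0$, and limits $\underline x,\overline x$ on its state of charge (SoC). From an initial SoC $x_0\in[\underline x,\overline x]$, charging powers $c_t$ and discharging powers $d_t$ ($t=1,\dots,T$) give $x_t=x_{t-1}+\frac{\tau\eta_c}{E}c_t-\frac{\tau}{\eta_dE}d_t$. The instruction signal is $r_t\in[-P,P]$, where $r_t\ge 0$ asks the battery to charge. With $[z]^+=\max\{z,0\}$, the cost of $(c,d)$ is $$J(c,d)=\tau\sum_{t=1}^T\Big(\theta\,[r_t-(c_t-d_t)]^+ +\pi\,[(c_t-d_t)-r_t]^+\Big)+EB\Big(\sum_i\tfrac{\Phi(v_i)}2+\sum_j\tfrac{\Phi(w_j)}2\Big),$$ where $v$ and $w$ are the depths of the charging and the discharging half cycles of the profile $(x_0,\dots,x_T)$ given by four-point rainflow counting: among the successive local extrema $s_1,s_2,\dots$ of the profile (endpoints included), whenever four successive ones satisfy $|s_2-s_3|\le|s_1-s_2|$ and $|s_2-s_3|\le|s_3-s_4|$,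 a full cycle of depth $|s_2-s_3|$ (one charging and one discharging half cycle) is recorded and $s_2,s_3$ are deleted; in the final residue each ascending (descending) step between consecutive points is a charging (discharging) half cycle. *Offline problem.* Call $(c,d)$ operable if $0\le c_t,d_t\le P$ and $\underline x\le x_t\le\overline x$ for $t=1,\dots,T$. Let $J^*$ be the infimum of $J$ over the operable $(c,d)$ that never exceed the instruction, i.e. $c_t\le[r_t]^+$ and $d_t\le[-r_t]^+$. *Online policy $g$.* Let $\hat u=\dot\Phi^{-1}\big(\frac{\pi\eta_d+\theta/\eta_c}{B}\big)$, where $\dot\Phi$ is the derivative of $\Phi$. In step $t$, let $x^{\max},x^{\min}$ be the maximum and minimum of $x_0,\dots,x_{t-1}$. If $r_t\ge 0$, put $c_t=\min\{\frac{E}{\tau\eta_c}(\min\{\overline x,x^{\min}+\hat u\}-x_{t-1}),\,r_t\}$ and $d_t=0$; if $r_t<0$, put $c_t=0$ and $d_t=\min\{\frac{E\eta_d}{\tau}(x_{t-1}-\max\{\underline x,x^{\max}-\hat u\}),\,-r_t\}$. Let $J_g$ be the cost of these actions. **Theorem (online optimality).** Suppose that the stress function $\Phi$ on $[0,\infty)$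 is strictly convex, differentiable and nondecreasing with $\Phi(0)=0$, and that $\frac{\pi\eta_d+\theta/\eta_c}{B}$ is a value of $\dot\Phi$ on $[0,\infty)$ (so that $\hat u\ge 0$ is defined). Then there is a constant $\varepsilon$, depending only on the parameters $E,\tau,\eta_c,\eta_d,P,B,\theta,\pi,\underline x,\overline x,\Phi$, such that for every horizon $T$, every initial SoC $x_0\in[\underline x,\overline x]$ and every signal $r\in[-P,P]^T$, the actions of $g$ are operable and never exceed the instruction, and $$J_g-J^*\le\varepsilon .$$ If moreover $\eta_c\eta_d=1$, the same bound holds when $J^*$ is replaced by the infimum of $J$ over all operable $(c,d)$, including those that exceed the instruction. -/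

import Mathlib

open Set

noncomputable section

namespace CycleAging

/-! ### Rainflow cycle counting -/

/-- Push the next sample `x` on a stack of turning points (most recent point first). A repeated
value is ignored, and a point in the middle of a monotone stretch is replaced by the new one. -/
def pushExtremum : List ℝ → ℝ → List ℝ
  | [], x => [x]
  | [a], x => if x = a then [a] else [x, a]
  | a :: b :: s, x =>
      if x = a then a :: b :: s
      else if (b < a ∧ a < x) ∨ (x < a ∧ a < b) then x :: b :: s
      else x :: a :: b :: s

/-- The successive local extrema `s₁, s₂, …` of a profile, in chronological order; the first and
the last sample of the profile count as extrema. -/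
def extrema (x : List ℝ) : List ℝ :=
  (x.foldl pushExtremum []).reverse

/-- The four-point test on a stack of points (most recent first). If the range between the two
middle points is at most both neighbouring ranges, then the two middle points are discarded, their
range is recorded as the depth of a full cycle, and the test is repeated on what remains.
Returns the remaining stack and the depths of the extracted full cycles. -/
def closeCycles : List ℝ → List ℝ × List ℝ
  | s₄ :: s₃ :: s₂ :: s₁ :: rest =>
      if |s₂ - s₃| ≤ |s₁ - s₂| ∧ |s₂ - s₃| ≤ |s₃ - s₄| then
        ((closeCycles (s₄ :: s₁ :: rest)).1,
          |s₂ - s₃| :: (closeCycles (s₄ :: s₁ :: rest)).2)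
      else (s₄ :: s₃ :: s₂ :: s₁ :: rest, [])
  | s => (s, [])
  termination_by s => s.length

/-- One step of the count: the next extremum is considered and all cycles that it closes are
extracted. The state is the current stack with the depths of the full cycles found so far. -/
def rainflowStep (st : List ℝ × List ℝ) (s : ℝ) : List ℝ × List ℝ :=
  ((closeCycles (s :: st.1)).1, (closeCycles (s :: st.1)).2 ++ st.2)

/-- Final state of the count: (residue, most recent point first; depths of the full cycles). -/
def rainflowState (x : List ℝ) : List ℝ × List ℝ :=
  (extrema x).foldl rainflowStep ([], [])

/-- Depths of the ascending steps between consecutive points of a chronological list. -/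
def ascents : List ℝ → List ℝ
  | a :: b :: l => if a < b then (b - a) :: ascents (b :: l) else ascents (b :: l)
  | _ => []

/-- Depths of the descending steps between consecutive points of a chronological list. -/
def descents : List ℝ → List ℝ
  | a :: b :: l => if b < a then (a - b) :: descents (b :: l) else descents (b :: l)
  | _ => []

/-- `(v, w) = Rainflow(x)`: the depths of the charging half cycles and of the discharging half
cycles. A full cycle is a charging half cycle and a discharging half cycle of the same depth;
two consecutive points of the residue form a charging or a discharging half cycle. -/
def rainflow (x : List ℝ) : List ℝ × List ℝ :=
  (ascents (rainflowState x).1.reverse ++ (rainflowState x).2,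
    descents (rainflowState x).1.reverse ++ (rainflowState x).2)

/-- Life loss of a profile: half the stress `Φ` of every half cycle. -/
def lifeLoss (Φ : ℝ → ℝ) (x : List ℝ) : ℝ :=
  ((rainflow x).1.map fun v => Φ v / 2).sum + ((rainflow x).2.map fun w => Φ w / 2).sum

/-! ### The battery and the offline problem

Time steps are numbered `0, …, T - 1`; `c t`, `d t`, `r t` are the charging power, the discharging
power and the instruction in step `t`. Only the values at `t < T` matter. -/

/-- The parameters of the problem. -/
structure Battery where
  /-- rated energy capacity -/
  E : ℝ
  /-- duration of a control interval -/
  τ : ℝ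
  /-- charging efficiency -/
  ηc : ℝ
  /-- discharging efficiency: delivering power `d` drains the storage at rate `d / ηd` -/
  ηd : ℝ
  /-- power rating -/
  P : ℝ
  /-- unit price of cell replacement -/
  B : ℝ
  /-- price for surplus injections and deficient demands -/
  θ : ℝ
  /-- price for deficient injections and surplus demands -/
  π : ℝ
  /-- lower limit of the state of charge -/
  xlo : ℝ
  /-- upper limit of the state of charge -/
  xhi : ℝ
  /-- cycle depth stress function -/
  Φ : ℝ → ℝ
  E_pos : 0 < E
  τ_pos : 0 < τ
  ηc_pos : 0 < ηc
  ηd_pos : 0 < ηd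
  B_pos : 0 < B
  θ_nonneg : 0 ≤ θ
  π_nonneg : 0 ≤ π

namespace Battery

variable (b : Battery)

/-- State of charge after one step with powers `c`, `d`, from the state of charge `x`. -/
def next (x c d : ℝ) : ℝ :=
  x + b.τ * b.ηc / b.E * c - b.τ / (b.ηd * b.E) * d

/-- State of charge: `soc x₀ c d t` is its value after the first `t` steps. -/
def soc (x₀ : ℝ) (c d : ℕ → ℝ) : ℕ → ℝ
  | 0 => x₀
  | t + 1 => b.next (soc x₀ c d t) (c t) (d t)

/-- Cycle aging cost over `T` steps, counted on the profile `x₀, x₁, …, x_T`. -/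
def agingCost (x₀ : ℝ) (c d : ℕ → ℝ) (T : ℕ) : ℝ :=
  lifeLoss b.Φ ((List.range (T + 1)).map (b.soc x₀ c d)) * b.B * b.E

/-- Penalty for deviating from the instruction. Positive `r t` instructs to charge, and
`c t - d t` is the net power drawn from the grid. -/
def penalty (c d r : ℕ → ℝ) (T : ℕ) : ℝ :=
  b.τ * ∑ t ∈ Finset.range T,
    (b.θ * max (r t - (c t - d t)) 0 + b.π * max ((c t - d t) - r t) 0)

/-- Total cost of the actions `(c, d)` under the signal `r`. -/
def cost (x₀ : ℝ) (r : ℕ → ℝ) (T : ℕ) (a : (ℕ → ℝ) × (ℕ → ℝ)) : ℝ :=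
  b.penalty a.1 a.2 r T + b.agingCost x₀ a.1 a.2 T

/-- Actions that respect the power rating and the limits of the state of charge. -/
def operable (x₀ : ℝ) (T : ℕ) : Set ((ℕ → ℝ) × (ℕ → ℝ)) :=
  {a | ∀ t < T, (0 ≤ a.1 t ∧ a.1 t ≤ b.P) ∧ (0 ≤ a.2 t ∧ a.2 t ≤ b.P) ∧
    b.soc x₀ a.1 a.2 (t + 1) ∈ Icc b.xlo b.xhi}

/-- Actions that never exceed the instruction: charge at most `[r t]⁺`, discharge at most
`[-r t]⁺`. -/
def withinSignal (r : ℕ → ℝ) (T : ℕ) : Set ((ℕ → ℝ) × (ℕ → ℝ)) :=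
  {a | ∀ t < T, a.1 t ≤ max (r t) 0 ∧ a.2 t ≤ max (-r t) 0}

/-- The offline optimum `J*`: the whole signal is known, and the actions respect the constraints
of the battery and never exceed the instruction. -/
def offlineOpt (x₀ : ℝ) (r : ℕ → ℝ) (T : ℕ) : ℝ :=
  sInf (b.cost x₀ r T '' (b.operable x₀ T ∩ withinSignal r T))

/-- The offline optimum over all actions that respect the constraints of the battery, whether or
not they exceed the instruction. -/
def offlineOptFree (x₀ : ℝ) (r : ℕ → ℝ) (T : ℕ) : ℝ :=
  sInf (b.cost x₀ r T '' b.operable x₀ T)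

/-! ### The online threshold policy -/

/-- The derivative of the stress function on depths `u ≥ 0` (one-sided at `0`). -/
def stressDeriv : ℝ → ℝ := derivWithin b.Φ (Ici 0)

/-- The marginal price `(π ηd + θ / ηc) / B` that defines the threshold. -/
def marginalPrice : ℝ := (b.π * b.ηd + b.θ / b.ηc) / b.B

/-- The threshold `û`: the inverse of the derivative of `Φ` at the marginal price. -/
def threshold : ℝ := Function.invFunOn b.stressDeriv (Ici 0) b.marginalPrice

/-- What the controller knows before a step: the current state of charge, and its maximum and
minimum since the beginning of the operation. -/
structure Controller where
  x : ℝ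
  xmax : ℝ
  xmin : ℝ

/-- Upper bound on the state of charge enforced by the controller. -/
def upperBound (s : Controller) : ℝ := min b.xhi (s.xmin + b.threshold)

/-- Lower bound on the state of charge enforced by the controller. -/
def lowerBound (s : Controller) : ℝ := max b.xlo (s.xmax - b.threshold)

/-- Charging power chosen by the policy under the instruction `r`. -/
def policyCharge (s : Controller) (r : ℝ) : ℝ :=
  if 0 ≤ r then min (b.E / (b.τ * b.ηc) * (b.upperBound s - s.x)) r else 0

/-- Discharging power chosen by the policy under the instruction `r`. -/
def policyDischarge (s : Controller) (r : ℝ) : ℝ :=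
  if 0 ≤ r then 0 else min (b.E * b.ηd / b.τ * (s.x - b.lowerBound s)) (-r)

/-- The controller after one step. -/
def policyStep (s : Controller) (r : ℝ) : Controller where
  x := b.next s.x (b.policyCharge s r) (b.policyDischarge s r)
  xmax := max s.xmax (b.next s.x (b.policyCharge s r) (b.policyDischarge s r))
  xmin := min s.xmin (b.next s.x (b.policyCharge s r) (b.policyDischarge s r))

/-- The controller before step `t`. It depends only on `x₀` and `r 0, …, r (t - 1)`. -/
def controller (x₀ : ℝ) (r : ℕ → ℝ) : ℕ → Controller
  | 0 => ⟨x₀, x₀, x₀⟩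
  | t + 1 => b.policyStep (controller x₀ r t) (r t)

/-- The actions of the online policy. -/
def onlineActions (x₀ : ℝ) (r : ℕ → ℝ) : (ℕ → ℝ) × (ℕ → ℝ) :=
  (fun t => b.policyCharge (b.controller x₀ r t) (r t),
    fun t => b.policyDischarge (b.controller x₀ r t) (r t))

/-- The cost `J_g` of the online policy. -/
def onlineCost (x₀ : ℝ) (r : ℕ → ℝ) (T : ℕ) : ℝ :=
  b.cost x₀ r T (b.onlineActions x₀ r)

end Battery

end CycleAging

end

noncomputable section

namespace CycleAging

/-! ### The stop operator and rainflow counting -/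

/-! The depths of all half cycles add up to the total variation of the SoC profile
(`sum_halfCycles`). For actions within the signal, and for all actions if `ηc * ηd = 1`, the penalty
is a constant minus a multiple of this variation, up to a boundary term in the final SoC and a
charge for the excess over the signal. Hence (`cost_eq`) minimizing the cost amounts, up to these
two terms, to maximizing the sum over half cycles of `saving u = marginalPrice * u - Φ u`, a concave
function with maximum at the threshold.

Two such sums are compared by majorization. Depths beyond the threshold may be cut down to it, and
below it `saving` is, on any finite set of depths, a nonnegative combination of truncations `min ·
h` (`exists_eq_sum_min`). So it suffices to compare the sums of `min u h` for each width `h` up to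
the threshold.

Such a sum is, up to an error `h` independent of the horizon, the variation of the stop operator of
width `h`, which follows the increments of the profile and is clipped to `[0, h]`. Deleting a full
cycle of depth `u` removes exactly `2 * min u h` from this variation (`stop_fullCycle`), and the
residue, whose swings grow and then shrink, loses at most `h` (`sum_min_swings_le`).

Finally, a stop operator that follows the signal greedily has the largest variation: its distance to
a competitor's state serves as a potential (`coupling_step`). The policy is greedy in this sense
simultaneously for all relevant widths, because whenever it holds back, the stop operator is already
at the end of its range (`greedy_controller`). A competitor exceeding the signal gains at most twice
the excess, which the penalty takes back exactly. -/

/-- Projection of `z` on the interval `[0, h]`. -/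
def clip (h z : ℝ) : ℝ := max 0 (min h z)

theorem clip_nonneg (h z : ℝ) : 0 ≤ clip h z := le_max_left _ _

theorem clip_le {h : ℝ} (hh : 0 ≤ h) (z : ℝ) : clip h z ≤ h := max_le hh (min_le_left _ _)

theorem clip_of_nonneg {h z : ℝ} (hh : 0 ≤ h) (hz : 0 ≤ z) : clip h z = min h z :=
  max_eq_right (le_min hh hz)

theorem clip_of_le {h z : ℝ} (hz : z ≤ h) : clip h z = max 0 z := by
  rw [clip, min_eq_right hz]

/-- Depths of the steps between consecutive points. -/
def swings : List ℝ → List ℝ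
  | a :: b :: l => |a - b| :: swings (b :: l)
  | _ => []

/-- Final state of the stop operator of width `h`, started at `σ`, along a stack of points
(most recent first). -/
def stopState (h σ : ℝ) : List ℝ → ℝ
  | a :: b :: l => clip h (stopState h σ (b :: l) + (a - b))
  | _ => σ

/-- Total variation of the stop operator along a stack of points (most recent first). -/
def stopVar (h σ : ℝ) : List ℝ → ℝ
  | a :: b :: l =>
    stopVar h σ (b :: l) + |stopState h σ (a :: b :: l) - stopState h σ (b :: l)|
  | _ => 0

/-- Consecutive points differ and the direction changes at every interior point. -/
def Zigzag : List ℝ → Prop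
  | a :: b :: c :: l => ((b < a ∧ b < c) ∨ (a < b ∧ c < b)) ∧ Zigzag (b :: c :: l)
  | [a, b] => a ≠ b
  | _ => True

/-- No four consecutive points pass the four-point test. -/
def NoFullCycle : List ℝ → Prop
  | s₄ :: s₃ :: s₂ :: s₁ :: l =>
    ¬ (|s₂ - s₃| ≤ |s₁ - s₂| ∧ |s₂ - s₃| ≤ |s₃ - s₄|) ∧ NoFullCycle (s₃ :: s₂ :: s₁ :: l)
  | _ => True

theorem Zigzag.tail {a : ℝ} {l : List ℝ} (h : Zigzag (a :: l)) : Zigzag l := by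
  match l, h with
  | [], _ => trivial
  | [b], _ => trivial
  | b :: c :: l, h => exact h.2

theorem NoFullCycle.tail {a : ℝ} {l : List ℝ} (h : NoFullCycle (a :: l)) : NoFullCycle l := by
  match l, h with
  | [], _ => trivial
  | [_], _ => trivial
  | [_, _], _ => trivial
  | _ :: _ :: _ :: _, h => exact h.2

theorem stopState_mem {h σ : ℝ} (hσ : σ ∈ Icc 0 h) (l : List ℝ) : stopState h σ l ∈ Icc 0 h := by
  match l with
  | [] => exact hσ
  | [_] => exact hσ
  | a :: b :: l => exact ⟨clip_nonneg _ _, clip_le (hσ.1.trans hσ.2) _⟩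

/-- Two moves in the same direction have the same effect on the stop operator as their sum. -/
theorem clip_clip_add {h σ p q : ℝ} (hσ : σ ∈ Icc 0 h) (hpq : (0 < p ∧ 0 < q) ∨ (p < 0 ∧ q < 0)) :
    clip h (clip h (σ + p) + q) = clip h (σ + (p + q)) ∧
      |clip h (σ + p) - σ| + |clip h (clip h (σ + p) + q) - clip h (σ + p)| =
        |clip h (σ + (p + q)) - σ| := by
  obtain ⟨h0, h1⟩ := hσ
  have hh := h0.trans h1
  rcases hpq with ⟨hp, hq⟩ | ⟨hp, hq⟩
  · rw [clip_of_nonneg hh (by linarith : 0 ≤ σ + p),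
      clip_of_nonneg hh (by linarith : 0 ≤ σ + (p + q)),
      clip_of_nonneg hh (add_nonneg (le_min hh (by linarith)) hq.le)]
    have e : min h (min h (σ + p) + q) = min h (σ + (p + q)) := by
      simp only [min_def]; split_ifs <;> linarith
    rw [e]
    refine ⟨rfl, ?_⟩
    rw [abs_of_nonneg, abs_of_nonneg, abs_of_nonneg]
    · ring
    all_goals simp only [min_def]; split_ifs <;> linarith
  · have h2 : max 0 (σ + p) + q ≤ h := by
      simp only [max_def]; split_ifs <;> linarith
    rw [clip_of_le (by linarith : σ + p ≤ h),
      clip_of_le (by linarith : σ + (p + q) ≤ h), clip_of_le h2]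
    have e : max 0 (max 0 (σ + p) + q) = max 0 (σ + (p + q)) := by
      simp only [max_def]; split_ifs <;> linarith
    rw [e]
    refine ⟨rfl, ?_⟩
    rw [abs_of_nonpos, abs_of_nonpos, abs_of_nonpos]
    · ring
    all_goals simp only [max_def]; split_ifs <;> linarith

/-- The effect on the stop operator of a full cycle inside a move. -/
theorem clip_fullCycle_up {h σ p u q : ℝ} (hσ : σ ∈ Icc 0 h) (hu : 0 < u) (hp : u ≤ p)
    (hq : u ≤ q) :
    clip h (clip h (clip h (σ + p) - u) + q) = clip h (σ + (p - u + q)) ∧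
      |clip h (σ + p) - σ| + |clip h (clip h (σ + p) - u) - clip h (σ + p)| +
          |clip h (clip h (clip h (σ + p) - u) + q) - clip h (clip h (σ + p) - u)| =
        |clip h (σ + (p - u + q)) - σ| + 2 * min u h := by
  obtain ⟨h0, h1⟩ := hσ
  have hh := h0.trans h1
  have e1 : clip h (σ + p) = min h (σ + p) := clip_of_nonneg hh (by linarith)
  have e2 : clip h (clip h (σ + p) - u) = max 0 (min h (σ + p) - u) := by
    rw [e1, clip_of_le]
    linarith [min_le_left h (σ + p)]
  have e3 : clip h (clip h (clip h (σ + p) - u) + q) = min h (σ + (p - u + q)) := by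
    rw [e2, clip_of_nonneg hh (add_nonneg (le_max_left _ _) (by linarith))]
    simp only [min_def, max_def]; split_ifs <;> linarith
  have e4 : clip h (σ + (p - u + q)) = min h (σ + (p - u + q)) :=
    clip_of_nonneg hh (by linarith)
  refine ⟨e3.trans e4.symm, ?_⟩
  rw [e3, e2, e4, e1]
  have a1 : 0 ≤ min h (σ + p) - σ := by simp only [min_def]; split_ifs <;> linarith
  -- Having risen by `p ≥ u`, the stop operator is at least at `min u h`, so the fall by `u` costs
  -- exactly `min u h`.
  have a2 : max 0 (min h (σ + p) - u) - min h (σ + p) = - min u h := by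
    simp only [min_def, max_def]; split_ifs <;> linarith
  have a3 : 0 ≤ min h (σ + (p - u + q)) - max 0 (min h (σ + p) - u) := by
    simp only [min_def, max_def]; split_ifs <;> linarith
  have a4 : 0 ≤ min h (σ + (p - u + q)) - σ := by simp only [min_def]; split_ifs <;> linarith
  rw [a2, abs_neg, abs_of_nonneg a1, abs_of_nonneg a3, abs_of_nonneg a4,
    abs_of_nonneg (le_min hu.le hh)]
  linarith

theorem clip_sub {h : ℝ} (hh : 0 ≤ h) (z : ℝ) : clip h (h - z) = h - clip h z := by
  simp only [clip, min_def, max_def]; split_ifs <;> linarith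

/-- The reflection `y ↦ h - y` exchanges rises and falls. -/
theorem clip_fullCycle_down {h σ p u q : ℝ} (hσ : σ ∈ Icc 0 h) (hu : 0 < u) (hp : u ≤ p)
    (hq : u ≤ q) :
    clip h (clip h (clip h (σ - p) + u) - q) = clip h (σ - (p - u + q)) ∧
      |clip h (σ - p) - σ| + |clip h (clip h (σ - p) + u) - clip h (σ - p)| +
          |clip h (clip h (clip h (σ - p) + u) - q) - clip h (clip h (σ - p) + u)| =
        |clip h (σ - (p - u + q)) - σ| + 2 * min u h := by
  have hh := hσ.1.trans hσ.2
  have key := clip_fullCycle_up (h := h) (σ := h - σ) ⟨by linarith [hσ.2], by linarith [hσ.1]⟩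
    hu hp hq
  have f1 : ∀ z, clip h (h - σ + z) = h - clip h (σ - z) := fun z => by
    rw [← clip_sub hh]; congr 1; ring
  have f2 : ∀ a, clip h (h - a - u) = h - clip h (a + u) := fun a => by
    rw [← clip_sub hh]; congr 1; ring
  have f3 : ∀ a, clip h (h - a + q) = h - clip h (a - q) := fun a => by
    rw [← clip_sub hh]; congr 1; ring
  rw [f1, f1, f2, f3] at key
  have g : ∀ a c : ℝ, |h - a - (h - c)| = |a - c| := fun a c => by
    rw [abs_sub_comm]; congr 1; ring
  simp only [g] at key
  exact ⟨by linarith [key.1], key.2⟩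

/-! ### Deletion of full cycles from a stack -/

/-- The inner swing is no longer than its neighbours, so `s₄` lies at or beyond `s₂`, hence strictly
beyond `s₁`: the merged swing keeps the direction of the outer ones. The extra point `x` records
that `s₄` stays a turning point. -/
theorem zigzag_skip {x s₄ s₃ s₂ s₁ : ℝ} {l : List ℝ}
    (hz : Zigzag (x :: s₄ :: s₃ :: s₂ :: s₁ :: l))
    (hc : |s₂ - s₃| ≤ |s₁ - s₂| ∧ |s₂ - s₃| ≤ |s₃ - s₄|) : Zigzag (x :: s₄ :: s₁ :: l) := by
  obtain ⟨h1, h2, h3, h4⟩ := hz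
  have key : (s₃ < s₄ ∧ s₁ < s₂ ∧ s₁ < s₄ ∧ x < s₄) ∨ (s₄ < s₃ ∧ s₂ < s₁ ∧ s₄ < s₁ ∧ s₄ < x) := by
    obtain ⟨c1, c2⟩ := hc
    rcases h2 with h2 | h2
    · have : s₁ < s₂ := by rcases h3 with h3 | h3 <;> linarith [h3.1, h3.2]
      rw [abs_of_pos (by linarith)] at c1 c2
      rw [abs_of_neg (by linarith)] at c1 c2
      left
      refine ⟨h2.1, this, by linarith, ?_⟩
      rcases h1 with h1 | h1 <;> linarith [h1.1, h1.2]
    · have : s₂ < s₁ := by rcases h3 with h3 | h3 <;> linarith [h3.1, h3.2]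
      rw [abs_of_neg (by linarith)] at c1 c2
      rw [abs_of_pos (by linarith)] at c1 c2
      right
      refine ⟨h2.1, this, by linarith, ?_⟩
      rcases h1 with h1 | h1 <;> linarith [h1.1, h1.2]
  match l, h4 with
  | [], h4 =>
    refine ⟨?_, ?_⟩
    · rcases key with k | k
      · exact Or.inr ⟨k.2.2.2, k.2.2.1⟩
      · exact Or.inl ⟨k.2.2.2, k.2.2.1⟩
    · rcases key with k | k
      · exact k.2.2.1.ne'
      · exact k.2.2.1.ne
  | c :: l, h4 =>
    refine ⟨?_, ?_, h4.2⟩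
    · rcases key with k | k
      · exact Or.inr ⟨k.2.2.2, k.2.2.1⟩
      · exact Or.inl ⟨k.2.2.2, k.2.2.1⟩
    · rcases key with k | k
      · left
        exact ⟨k.2.2.1, by rcases h4.1 with h | h <;> linarith [h.1, h.2]⟩
      · right
        exact ⟨k.2.2.1, by rcases h4.1 with h | h <;> linarith [h.1, h.2]⟩

theorem zigzag_skip_head {s₄ s₃ s₂ s₁ : ℝ} {l : List ℝ}
    (hz : Zigzag (s₄ :: s₃ :: s₂ :: s₁ :: l))
    (hc : |s₂ - s₃| ≤ |s₁ - s₂| ∧ |s₂ - s₃| ≤ |s₃ - s₄|) : Zigzag (s₄ :: s₁ :: l) := by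
  -- An auxiliary point beyond `s₄` turns it into an interior turning point.
  rcases hz.1 with h | h
  · exact (zigzag_skip (x := s₄ - 1) ⟨Or.inr ⟨by linarith, h.1⟩, hz⟩ hc).tail
  · exact (zigzag_skip (x := s₄ + 1) ⟨Or.inl ⟨by linarith, h.1⟩, hz⟩ hc).tail

theorem closeCycles_of_closed {s₄ s₃ s₂ s₁ : ℝ} {l : List ℝ}
    (hc : |s₂ - s₃| ≤ |s₁ - s₂| ∧ |s₂ - s₃| ≤ |s₃ - s₄|) :
    closeCycles (s₄ :: s₃ :: s₂ :: s₁ :: l) =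
      ((closeCycles (s₄ :: s₁ :: l)).1, |s₂ - s₃| :: (closeCycles (s₄ :: s₁ :: l)).2) := by
  rw [closeCycles, if_pos hc]

theorem closeCycles_of_not_closed {s₄ s₃ s₂ s₁ : ℝ} {l : List ℝ}
    (hc : ¬ (|s₂ - s₃| ≤ |s₁ - s₂| ∧ |s₂ - s₃| ≤ |s₃ - s₄|)) :
    closeCycles (s₄ :: s₃ :: s₂ :: s₁ :: l) = (s₄ :: s₃ :: s₂ :: s₁ :: l, []) := by
  rw [closeCycles, if_neg hc]

/-- Induction along the deletion of full cycles from a stack. -/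
theorem closeCycles_induction {p : List ℝ → List ℝ × List ℝ → Prop}
    (unchanged : ∀ l, (NoFullCycle l.tail → NoFullCycle l) → p l (l, []))
    (close : ∀ s₄ s₃ s₂ s₁ l R C, |s₂ - s₃| ≤ |s₁ - s₂| ∧ |s₂ - s₃| ≤ |s₃ - s₄| →
      p (s₄ :: s₁ :: l) (R, C) → p (s₄ :: s₃ :: s₂ :: s₁ :: l) (R, |s₂ - s₃| :: C)) :
    ∀ l : List ℝ, p l (closeCycles l)
  | s₄ :: s₃ :: s₂ :: s₁ :: l => by
    by_cases hc : |s₂ - s₃| ≤ |s₁ - s₂| ∧ |s₂ - s₃| ≤ |s₃ - s₄|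
    · rw [closeCycles_of_closed hc]
      exact close _ _ _ _ _ _ _ hc (closeCycles_induction unchanged close (s₄ :: s₁ :: l))
    · rw [closeCycles_of_not_closed hc]
      exact unchanged _ fun ht => ⟨hc, ht⟩
  | [] => by
    rw [closeCycles]
    · exact unchanged _ fun _ => trivial
    all_goals simp
  | [_] => by
    rw [closeCycles]
    · exact unchanged _ fun _ => trivial
    all_goals simp
  | [_, _] => by
    rw [closeCycles]
    · exact unchanged _ fun _ => trivial
    all_goals simp
  | [_, _, _] => by
    rw [closeCycles]
    · exact unchanged _ fun _ => trivial
    all_goals simp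
  termination_by l => l.length

theorem head?_closeCycles (l : List ℝ) : (closeCycles l).1.head? = l.head? :=
  closeCycles_induction (p := fun l r => r.1.head? = l.head?) (fun _ _ => rfl)
    (fun _ _ _ _ _ _ _ _ ih => by simpa using ih) l

theorem zigzag_cons_closeCycles {x : ℝ} (l : List ℝ) :
    Zigzag (x :: l) → Zigzag (x :: (closeCycles l).1) :=
  closeCycles_induction (p := fun l r => Zigzag (x :: l) → Zigzag (x :: r.1)) (fun _ _ h => h)
    (fun _ _ _ _ _ _ _ hc ih h => ih (zigzag_skip h hc)) l

theorem zigzag_closeCycles (l : List ℝ) : Zigzag l → Zigzag (closeCycles l).1 :=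
  closeCycles_induction (p := fun l r => Zigzag l → Zigzag r.1) (fun _ _ h => h)
    (fun _ _ _ _ _ _ _ hc ih h => ih (zigzag_skip_head h hc)) l

/-- Only the window at the top of the stack can pass the test, and the deletions stop exactly when
it fails or fewer than four points remain. -/
theorem noFullCycle_closeCycles (l : List ℝ) :
    NoFullCycle l.tail → NoFullCycle (closeCycles l).1 :=
  closeCycles_induction (p := fun l r => NoFullCycle l.tail → NoFullCycle r.1) (fun _ h => h)
    (fun _ _ _ _ _ _ _ _ ih h => ih (NoFullCycle.tail (NoFullCycle.tail h))) l

theorem closeCycles_mem_Icc {lo hi : ℝ} (l : List ℝ) :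
    (∀ a ∈ l, a ∈ Icc lo hi) →
      (∀ a ∈ (closeCycles l).1, a ∈ Icc lo hi) ∧
        ∀ u ∈ (closeCycles l).2, 0 ≤ u ∧ u ≤ hi - lo :=
  closeCycles_induction (p := fun l r => (∀ a ∈ l, a ∈ Icc lo hi) →
      (∀ a ∈ r.1, a ∈ Icc lo hi) ∧ ∀ u ∈ r.2, 0 ≤ u ∧ u ≤ hi - lo)
    (fun _ _ h => ⟨h, by simp⟩)
    (fun s₄ s₃ s₂ s₁ l R C _ ih h => by
      simp only [List.forall_mem_cons] at h ih ⊢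
      obtain ⟨h4, h3, h2, h1, hl⟩ := h
      refine ⟨(ih ⟨h4, h1, hl⟩).1, ⟨abs_nonneg _, ?_⟩, (ih ⟨h4, h1, hl⟩).2⟩
      rw [abs_le]
      constructor <;> linarith [h3.1, h3.2, h2.1, h2.2]) l

/-- Deleting a full cycle does not change the state of the stop operator, and removes twice the
truncated depth from its variation. -/
theorem stop_fullCycle {h σ s₄ s₃ s₂ s₁ : ℝ} {l : List ℝ} (hσ : σ ∈ Icc 0 h)
    (hz : Zigzag (s₄ :: s₃ :: s₂ :: s₁ :: l))
    (hc : |s₂ - s₃| ≤ |s₁ - s₂| ∧ |s₂ - s₃| ≤ |s₃ - s₄|) :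
    stopState h σ (s₄ :: s₃ :: s₂ :: s₁ :: l) = stopState h σ (s₄ :: s₁ :: l) ∧
      stopVar h σ (s₄ :: s₃ :: s₂ :: s₁ :: l) =
        stopVar h σ (s₄ :: s₁ :: l) + 2 * min |s₂ - s₃| h := by
  obtain ⟨h2, h3, -⟩ := hz
  obtain ⟨c1, c2⟩ := hc
  have hs := stopState_mem hσ (s₁ :: l)
  simp only [stopState, stopVar]
  set y := stopState h σ (s₁ :: l)
  rcases h2 with h2 | h2
  · have : s₁ < s₂ := by rcases h3 with h3 | h3 <;> linarith [h3.1, h3.2]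
    have e : |s₂ - s₃| = s₂ - s₃ := abs_of_pos (by linarith)
    have e1 : |s₁ - s₂| = s₂ - s₁ := by rw [abs_sub_comm]; exact abs_of_pos (by linarith)
    have e2 : |s₃ - s₄| = s₄ - s₃ := by rw [abs_sub_comm]; exact abs_of_pos (by linarith)
    rw [e, e1] at c1
    rw [e, e2] at c2
    have key := clip_fullCycle_up hs (by linarith : 0 < s₂ - s₃) c1 c2
    have f1 : ∀ a, a - (s₂ - s₃) = a + (s₃ - s₂) := fun a => by ring
    have f2 : s₂ - s₁ - (s₂ - s₃) + (s₄ - s₃) = s₄ - s₁ := by ring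
    rw [f2, f1] at key
    rw [e]
    exact ⟨key.1, by linarith [key.2]⟩
  · have : s₂ < s₁ := by rcases h3 with h3 | h3 <;> linarith [h3.1, h3.2]
    have e : |s₂ - s₃| = s₃ - s₂ := by rw [abs_sub_comm]; exact abs_of_pos (by linarith)
    have e1 : |s₁ - s₂| = s₁ - s₂ := abs_of_pos (by linarith)
    have e2 : |s₃ - s₄| = s₃ - s₄ := abs_of_pos (by linarith)
    rw [e, e1] at c1
    rw [e, e2] at c2
    have key := clip_fullCycle_down hs (by linarith : 0 < s₃ - s₂) c1 c2
    have f1 : ∀ a, a - (s₃ - s₄) = a + (s₄ - s₃) := fun a => by ring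
    have f2 : y - (s₁ - s₂ - (s₃ - s₂) + (s₃ - s₄)) = y + (s₄ - s₁) := by ring
    have f3 : y - (s₁ - s₂) = y + (s₂ - s₁) := by ring
    rw [f2, f1, f3] at key
    rw [e]
    exact ⟨key.1, by linarith [key.2]⟩

/-- The untruncated counterpart of `stop_fullCycle`, for the total variation of the profile itself.
-/
theorem sum_swings_fullCycle {s₄ s₃ s₂ s₁ : ℝ} {l : List ℝ}
    (hz : Zigzag (s₄ :: s₃ :: s₂ :: s₁ :: l))
    (hc : |s₂ - s₃| ≤ |s₁ - s₂| ∧ |s₂ - s₃| ≤ |s₃ - s₄|) :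
    (swings (s₄ :: s₃ :: s₂ :: s₁ :: l)).sum =
      (swings (s₄ :: s₁ :: l)).sum + 2 * |s₂ - s₃| := by
  obtain ⟨h2, h3, -⟩ := hz
  obtain ⟨c1, c2⟩ := hc
  simp only [swings, List.sum_cons]
  rcases h2 with h2 | h2
  · have : s₁ < s₂ := by rcases h3 with h3 | h3 <;> linarith [h3.1, h3.2]
    have e : |s₂ - s₃| = s₂ - s₃ := abs_of_pos (by linarith)
    have e1 : |s₁ - s₂| = s₂ - s₁ := by rw [abs_sub_comm]; exact abs_of_pos (by linarith)
    have e2 : |s₃ - s₄| = s₄ - s₃ := by rw [abs_sub_comm]; exact abs_of_pos (by linarith)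
    rw [e, e1] at c1
    rw [e, e2] at c2
    have e3 : |s₄ - s₁| = s₄ - s₁ := abs_of_nonneg (by linarith)
    rw [abs_sub_comm s₄, abs_sub_comm s₃ s₂, abs_sub_comm s₂ s₁, e, e1, e2, e3]
    ring
  · have : s₂ < s₁ := by rcases h3 with h3 | h3 <;> linarith [h3.1, h3.2]
    have e : |s₂ - s₃| = s₃ - s₂ := by rw [abs_sub_comm]; exact abs_of_pos (by linarith)
    have e1 : |s₁ - s₂| = s₁ - s₂ := abs_of_pos (by linarith)
    have e2 : |s₃ - s₄| = s₃ - s₄ := abs_of_pos (by linarith)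
    rw [e, e1] at c1
    rw [e, e2] at c2
    have e3 : |s₄ - s₁| = s₁ - s₄ := by rw [abs_sub_comm]; exact abs_of_nonneg (by linarith)
    rw [abs_sub_comm s₄ s₃, abs_sub_comm s₃ s₂, abs_sub_comm s₂ s₁, e, e1, e2, e3]
    ring

theorem stop_closeCycles {h σ : ℝ} (hσ : σ ∈ Icc 0 h) (l : List ℝ) :
    Zigzag l → stopState h σ (closeCycles l).1 = stopState h σ l ∧
      stopVar h σ l = stopVar h σ (closeCycles l).1 +
        2 * ((closeCycles l).2.map fun u => min u h).sum :=
  closeCycles_induction (p := fun l r => Zigzag l → stopState h σ r.1 = stopState h σ l ∧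
      stopVar h σ l = stopVar h σ r.1 + 2 * (r.2.map fun u => min u h).sum)
    (fun _ _ _ => ⟨rfl, by simp⟩)
    (fun s₄ s₃ s₂ s₁ l R C hc ih hz => by
      obtain ⟨i1, i2⟩ := ih (zigzag_skip_head hz hc)
      obtain ⟨k1, k2⟩ := stop_fullCycle hσ hz hc
      refine ⟨i1.trans k1.symm, ?_⟩
      simp only [List.map_cons, List.sum_cons] at i2 ⊢
      linarith) l

theorem sum_swings_closeCycles (l : List ℝ) :
    Zigzag l → (swings l).sum = (swings (closeCycles l).1).sum + 2 * (closeCycles l).2.sum :=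
  closeCycles_induction (p := fun l r => Zigzag l →
      (swings l).sum = (swings r.1).sum + 2 * r.2.sum)
    (fun _ _ _ => by simp)
    (fun s₄ s₃ s₂ s₁ l R C hc ih hz => by
      have := ih (zigzag_skip_head hz hc)
      have := sum_swings_fullCycle hz hc
      simp only [List.sum_cons] at *
      linarith) l

/-! ### Truncated depths and variation of the stop operator on the residue -/

/-- After a swing of depth `v`, a swing of depth `u` in the opposite direction moves the stop
operator by at least `min u v`, unless it crosses the whole range. -/
theorem min_le_abs_clip_sub {h σ u v : ℝ} (hσ : σ ∈ Icc 0 h)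
    (huv : (u < 0 ∧ 0 < v) ∨ (0 < u ∧ v < 0)) :
    min (min |u| |v|) h ≤ |clip h (clip h (σ + v) + u) - clip h (σ + v)| := by
  obtain ⟨h0, h1⟩ := hσ
  have hh := h0.trans h1
  rcases huv with ⟨hu, hv⟩ | ⟨hu, hv⟩
  · rw [abs_of_neg hu, abs_of_pos hv, clip_of_nonneg hh (by linarith : 0 ≤ σ + v), clip_of_le]
    · rw [abs_of_nonpos] <;> simp only [min_def, max_def] <;> split_ifs <;> linarith
    · linarith [min_le_left h (σ + v)]
  · rw [abs_of_pos hu, abs_of_neg hv, clip_of_le (by linarith : σ + v ≤ h), clip_of_nonneg hh]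
    · rw [abs_of_nonneg] <;> simp only [min_def, max_def] <;> split_ifs <;> linarith
    · linarith [le_max_left 0 (σ + v)]

theorem abs_clip_sub_le {h σ u : ℝ} (hσ : σ ∈ Icc 0 h) : |clip h (σ + u) - σ| ≤ min |u| h := by
  obtain ⟨h0, h1⟩ := hσ
  simp only [clip, min_def, max_def, abs]
  split_ifs <;> linarith

theorem stopVar_le {h σ : ℝ} (hσ : σ ∈ Icc 0 h) :
    ∀ l : List ℝ, stopVar h σ l ≤ ((swings l).map fun u => min u h).sum
  | [] => by simp [stopVar, swings]
  | [_] => by simp [stopVar, swings]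
  | a :: b :: l => by
    have := stopVar_le hσ (b :: l)
    have := abs_clip_sub_le (u := a - b) (stopState_mem hσ (b :: l))
    simp only [stopVar, swings, List.map_cons, List.sum_cons, stopState] at *
    linarith

/-- In the residue, the truncated depths exceed the variation of the stop operator by at most the
width. -/
theorem sum_min_swings_le {h σ : ℝ} (hσ : σ ∈ Icc 0 h) :
    ∀ l : List ℝ, Zigzag l → NoFullCycle l →
      ((swings l).map fun u => min u h).sum ≤ stopVar h σ l + h ∧
        ∀ a b c s, l = a :: b :: c :: s → |b - c| < |a - b| →
          ((swings l).map fun u => min u h).sum ≤ stopVar h σ l + min |a - b| h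
  | [], _, _ => by
    simp only [swings, stopVar]
    exact ⟨by simpa using hσ.1.trans hσ.2, by simp⟩
  | [_], _, _ => by
    simp only [swings, stopVar]
    exact ⟨by simpa using hσ.1.trans hσ.2, by simp⟩
  | [a, b], _, _ => by
    simp only [swings, stopVar]
    refine ⟨?_, by simp⟩
    simp only [List.map_cons, List.map_nil, List.sum_cons, List.sum_nil]
    linarith [min_le_right |a - b| h, abs_nonneg (stopState h σ [a, b] - stopState h σ [b])]
  | a :: b :: c :: s, hz, hn => by
    obtain ⟨i1, i2⟩ := sum_min_swings_le hσ (b :: c :: s) hz.tail hn.tail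
    have hm := min_le_abs_clip_sub (u := a - b) (v := b - c) (stopState_mem hσ (c :: s))
      (by rcases hz.1 with h | h
          · exact Or.inr ⟨by linarith [h.1], by linarith [h.2]⟩
          · exact Or.inl ⟨by linarith [h.1], by linarith [h.2]⟩)
    -- Without a full cycle among the top four points, a swing longer than its predecessor forces
    -- that one to be longer than its own predecessor. So growing swings come first, and the sharper
    -- induction hypothesis is available.
    have key : |b - c| < |a - b| →
        ((swings (b :: c :: s)).map fun u => min u h).sum ≤
          stopVar h σ (b :: c :: s) + min |b - c| h := by
      intro hlt
      match s, hn, i2 with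
      | [], _, _ =>
        simp only [swings, stopVar, List.map_cons, List.map_nil, List.sum_cons, List.sum_nil]
        linarith [abs_nonneg (stopState h σ [b, c] - stopState h σ [c])]
      | d :: s, hn, i2 =>
        refine i2 b c d s rfl (lt_of_not_ge fun hle => hn.1 ⟨?_, ?_⟩)
        · rwa [abs_sub_comm c b, abs_sub_comm d c]
        · rw [abs_sub_comm c b, abs_sub_comm b a]
          exact hlt.le
    have e : ((swings (a :: b :: c :: s)).map fun u => min u h).sum =
        min |a - b| h + ((swings (b :: c :: s)).map fun u => min u h).sum := by
      simp [swings]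
    have e' : stopVar h σ (a :: b :: c :: s) = stopVar h σ (b :: c :: s) +
      |clip h (clip h (stopState h σ (c :: s) + (b - c)) + (a - b)) -
        clip h (stopState h σ (c :: s) + (b - c))| := rfl
    rw [e, e']
    -- A swing that does not grow is matched by its own movement of the stop operator and adds no
    -- deficit. For a growing one the movement covers `min |b - c| h`, which pays the old deficit
    -- and leaves the new one `min |a - b| h`.
    rcases le_or_gt |a - b| |b - c| with hle | hlt
    · rw [min_eq_left hle] at hm
      refine ⟨by linarith, ?_⟩
      rintro _ _ _ _ ⟨⟩ h'
      exact absurd h' (not_lt.2 hle)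
    · rw [min_eq_right hlt.le] at hm
      have := key hlt
      refine ⟨by linarith [min_le_right |a - b| h], ?_⟩
      rintro _ _ _ _ ⟨⟩ _
      linarith

/-! ### The rainflow count of a stack of extrema -/

/-- The rainflow count on a stack of extrema (most recent first). -/
def countStack (S : List ℝ) : List ℝ × List ℝ :=
  S.foldr (fun s st => rainflowStep st s) ([], [])

theorem countStack_cons (s : ℝ) (S : List ℝ) :
    countStack (s :: S) = ((closeCycles (s :: (countStack S).1)).1,
      (closeCycles (s :: (countStack S).1)).2 ++ (countStack S).2) := rfl

theorem rainflowState_eq (x : List ℝ) :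
    rainflowState x = countStack (x.foldl pushExtremum []) := by
  rw [rainflowState, extrema, List.foldl_reverse]
  rfl

theorem head?_countStack (S : List ℝ) : (countStack S).1.head? = S.head? := by
  cases S with
  | nil => rfl
  | cons s S => rw [countStack_cons]; simp [head?_closeCycles]

theorem zigzag_cons_cons_of_head? {x s : ℝ} {S R : List ℝ} (hh : R.head? = S.head?)
    (hS : Zigzag (x :: s :: S)) (hR : Zigzag (s :: R)) : Zigzag (x :: s :: R) := by
  match S, R, hh, hS, hR with
  | [], [], _, hS, _ => exact hS
  | a :: S, b :: R, hh, hS, hR =>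
    obtain rfl : b = a := by simpa using hh
    exact ⟨hS.1, hR⟩

theorem zigzag_cons_countStack (S : List ℝ) :
    ∀ x, Zigzag (x :: S) → Zigzag (x :: (countStack S).1) := by
  induction S with
  | nil => exact fun _ h => h
  | cons s S ih =>
    intro x h
    rw [countStack_cons]
    exact zigzag_cons_closeCycles _
      (zigzag_cons_cons_of_head? (head?_countStack S) h (ih s h.tail))

theorem noFullCycle_countStack (S : List ℝ) : NoFullCycle (countStack S).1 := by
  induction S with
  | nil => trivial
  | cons s S ih => exact noFullCycle_closeCycles _ ih

theorem zigzag_countStack {S : List ℝ} (hS : Zigzag S) : Zigzag (countStack S).1 := by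
  cases S with
  | nil => trivial
  | cons s S =>
    have h := zigzag_cons_countStack S s hS
    have := zigzag_closeCycles _ h
    exact this

theorem countStack_mem_Icc {lo hi : ℝ} {S : List ℝ} (hS : ∀ a ∈ S, a ∈ Icc lo hi) :
    (∀ a ∈ (countStack S).1, a ∈ Icc lo hi) ∧
      ∀ u ∈ (countStack S).2, 0 ≤ u ∧ u ≤ hi - lo := by
  induction S with
  | nil => simp [countStack]
  | cons s S ih =>
    simp only [List.forall_mem_cons] at hS
    obtain ⟨i1, i2⟩ := ih hS.2
    have := closeCycles_mem_Icc (lo := lo) (hi := hi) (s :: (countStack S).1)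
      (by simpa only [List.forall_mem_cons] using ⟨hS.1, i1⟩)
    rw [countStack_cons]
    refine ⟨this.1, fun u hu => ?_⟩
    rcases List.mem_append.1 hu with hu | hu
    exacts [this.2 u hu, i2 u hu]

/-- A new point sees the stack only through its top and the stop state. Both agree for the residue
and the full stack, so the count may discard cycles as it goes. -/
theorem stop_cons_congr {h σ s : ℝ} {S R : List ℝ} (hh : R.head? = S.head?)
    (hs : stopState h σ R = stopState h σ S) :
    stopState h σ (s :: R) = stopState h σ (s :: S) ∧
      stopVar h σ (s :: R) - stopVar h σ R = stopVar h σ (s :: S) - stopVar h σ S := by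
  match S, R, hh with
  | [], [], _ => simp [stopState]
  | a :: S, b :: R, hh =>
    obtain rfl : b = a := by simpa using hh
    simp only [stopState, stopVar, hs]
    exact ⟨trivial, by ring⟩

theorem sum_swings_cons_congr {s : ℝ} {S R : List ℝ} (hh : R.head? = S.head?) :
    (swings (s :: R)).sum - (swings R).sum = (swings (s :: S)).sum - (swings S).sum := by
  match S, R, hh with
  | [], [], _ => rfl
  | a :: S, b :: R, hh =>
    obtain rfl : b = a := by simpa using hh
    simp only [swings, List.sum_cons]
    ring

theorem stop_countStack {h σ : ℝ} (hσ : σ ∈ Icc 0 h) {S : List ℝ} (hS : Zigzag S) :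
    stopState h σ (countStack S).1 = stopState h σ S ∧
      stopVar h σ S = stopVar h σ (countStack S).1 +
        2 * ((countStack S).2.map fun u => min u h).sum := by
  induction S with
  | nil => simp [countStack]
  | cons s S ih =>
    obtain ⟨i1, i2⟩ := ih hS.tail
    obtain ⟨c1, c2⟩ := stop_cons_congr (s := s) (head?_countStack S) i1
    obtain ⟨k1, k2⟩ := stop_closeCycles hσ _ (zigzag_cons_countStack S s hS)
    rw [countStack_cons]
    refine ⟨k1.trans c1, ?_⟩
    simp only [List.map_append, List.sum_append]
    linarith

theorem sum_swings_countStack {S : List ℝ} (hS : Zigzag S) :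
    (swings S).sum = (swings (countStack S).1).sum + 2 * (countStack S).2.sum := by
  induction S with
  | nil => simp [countStack]
  | cons s S ih =>
    have i2 := ih hS.tail
    have c2 := sum_swings_cons_congr (s := s) (head?_countStack S)
    have k2 := sum_swings_closeCycles _ (zigzag_cons_countStack S s hS)
    rw [countStack_cons]
    simp only [List.sum_append]
    linarith

/-- Depths of all half cycles counted on a stack of extrema. -/
def halfCycles (S : List ℝ) : List ℝ :=
  swings (countStack S).1 ++ ((countStack S).2 ++ (countStack S).2)

theorem sum_halfCycles {S : List ℝ} (hS : Zigzag S) : (halfCycles S).sum = (swings S).sum := by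
  simp only [halfCycles, List.sum_append, sum_swings_countStack hS]
  ring

theorem stopVar_le_sum_halfCycles {h σ : ℝ} (hσ : σ ∈ Icc 0 h) {S : List ℝ} (hS : Zigzag S) :
    stopVar h σ S ≤ ((halfCycles S).map fun u => min u h).sum := by
  have := stopVar_le hσ (countStack S).1
  simp only [halfCycles, List.map_append, List.sum_append, (stop_countStack hσ hS).2]
  linarith

/-- Extracted cycles are accounted for exactly, each as two half cycles; the error `h` comes from
the residue alone. -/
theorem sum_halfCycles_le_stopVar {h σ : ℝ} (hσ : σ ∈ Icc 0 h) {S : List ℝ} (hS : Zigzag S) :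
    ((halfCycles S).map fun u => min u h).sum ≤ stopVar h σ S + h := by
  have := (sum_min_swings_le hσ _ (zigzag_countStack hS) (noFullCycle_countStack S)).1
  simp only [halfCycles, List.map_append, List.sum_append, (stop_countStack hσ hS).2]
  linarith

theorem swings_mem_Icc {lo hi : ℝ} : ∀ l : List ℝ, (∀ a ∈ l, a ∈ Icc lo hi) →
    ∀ u ∈ swings l, 0 ≤ u ∧ u ≤ hi - lo
  | [], _ => by simp [swings]
  | [_], _ => by simp [swings]
  | a :: b :: l, h => by
    simp only [swings, List.forall_mem_cons] at h ⊢
    refine ⟨⟨abs_nonneg _, ?_⟩, swings_mem_Icc (b :: l) (by simpa using h.2)⟩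
    rw [abs_le]
    constructor <;> linarith [h.1.1, h.1.2, h.2.1.1, h.2.1.2]

theorem halfCycles_mem_Icc {lo hi : ℝ} {S : List ℝ} (hS : ∀ a ∈ S, a ∈ Icc lo hi) :
    ∀ u ∈ halfCycles S, 0 ≤ u ∧ u ≤ hi - lo := by
  obtain ⟨h1, h2⟩ := countStack_mem_Icc hS
  intro u hu
  simp only [halfCycles, List.mem_append, or_self] at hu
  rcases hu with hu | hu
  exacts [swings_mem_Icc _ h1 u hu, h2 u hu]

/-! ### Life loss as a sum over all half cycles -/

theorem sum_ascents_add_descents {f : ℝ → ℝ} (hf : f 0 = 0) : ∀ l : List ℝ,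
    ((ascents l).map f).sum + ((descents l).map f).sum = ((swings l).map f).sum
  | [] => by simp [ascents, descents, swings]
  | [_] => by simp [ascents, descents, swings]
  | a :: b :: l => by
    have ih := sum_ascents_add_descents hf (b :: l)
    simp only [ascents, descents, swings, List.map_cons, List.sum_cons]
    rcases lt_trichotomy a b with h | h | h
    · rw [if_pos h, if_neg h.not_gt, abs_sub_comm, abs_of_pos (sub_pos.2 h)]
      simp only [List.map_cons, List.sum_cons]
      linarith
    · simp only [h, lt_irrefl, if_false, sub_self, abs_zero, hf]
      linarith
    · rw [if_neg h.not_gt, if_pos h, abs_of_pos (sub_pos.2 h)]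
      simp only [List.map_cons, List.sum_cons]
      linarith

theorem swings_append_pair (l : List ℝ) (a b : ℝ) :
    swings (l ++ [a, b]) = swings (l ++ [a]) ++ [|a - b|] := by
  match l with
  | [] => rfl
  | [c] => rfl
  | c :: d :: l =>
    have := swings_append_pair (d :: l) a b
    simp only [List.cons_append, swings] at this ⊢
    rw [this]

theorem swings_reverse : ∀ l : List ℝ, swings l.reverse = (swings l).reverse
  | [] => rfl
  | [_] => rfl
  | a :: b :: l => by
    have := swings_reverse (b :: l)
    simp only [List.reverse_cons, List.append_assoc, List.cons_append, List.nil_append] at this ⊢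
    rw [swings_append_pair, this, swings, List.reverse_cons, abs_sub_comm]

theorem lifeLoss_eq {Φ : ℝ → ℝ} (hΦ : Φ 0 = 0) (x : List ℝ) :
    lifeLoss Φ x = ((halfCycles (x.foldl pushExtremum [])).map fun u => Φ u / 2).sum := by
  have h := sum_ascents_add_descents (f := fun u => Φ u / 2) (by simp [hΦ])
    (countStack (x.foldl pushExtremum [])).1.reverse
  rw [swings_reverse, List.map_reverse, List.sum_reverse] at h
  simp only [lifeLoss, rainflow, rainflowState_eq, halfCycles, List.map_append, List.sum_append]
  linarith

/-! ### Extrema of a growing profile -/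

theorem head?_pushExtremum (S : List ℝ) (x : ℝ) : (pushExtremum S x).head? = some x := by
  match S with
  | [] => rfl
  | [a] => simp only [pushExtremum]; split_ifs with h <;> simp [h]
  | a :: b :: s => simp only [pushExtremum]; split_ifs with h <;> simp [h]

theorem zigzag_pushExtremum {S : List ℝ} (hS : Zigzag S) (x : ℝ) : Zigzag (pushExtremum S x) := by
  match S, hS with
  | [], _ => trivial
  | [a], _ =>
    simp only [pushExtremum]
    split_ifs with h
    exacts [trivial, h]
  | a :: b :: s, hS =>
    simp only [pushExtremum]
    split_ifs with h h'
    · exact hS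
    · match s, hS with
      | [], _ =>
        rcases h' with h' | h'
        exacts [(h'.1.trans h'.2).ne', (h'.1.trans h'.2).ne]
      | c :: s, hS =>
        refine ⟨?_, hS.2⟩
        rcases hS.1 with k | k <;> rcases h' with h' | h'
        · exact Or.inl ⟨by linarith [h'.1, h'.2], k.2⟩
        · linarith [h'.1, h'.2, k.1]
        · linarith [h'.1, h'.2, k.1]
        · exact Or.inr ⟨by linarith [h'.1, h'.2], k.2⟩
    · refine ⟨?_, hS⟩
      have hab : a ≠ b := by
        match s, hS with
        | [], hS => exact hS
        | c :: s, hS => rcases hS.1 with k | k; exacts [k.1.ne', k.1.ne]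
      rw [not_or, not_and, not_and] at h'
      rcases lt_or_gt_of_ne hab with hab | hab
      · exact Or.inl ⟨lt_of_le_of_ne (not_lt.1 fun k => h'.2 k hab) (Ne.symm h), hab⟩
      · exact Or.inr ⟨lt_of_le_of_ne (not_lt.1 fun k => h'.1 hab k) h, hab⟩

theorem mem_pushExtremum {S : List ℝ} {x a : ℝ} (ha : a ∈ pushExtremum S x) : a = x ∨ a ∈ S := by
  match S with
  | [] => simpa [pushExtremum] using ha
  | [b] =>
    simp only [pushExtremum] at ha
    split_ifs at ha <;> simp_all
  | b :: c :: s =>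
    simp only [pushExtremum] at ha
    split_ifs at ha <;> simp only [List.mem_cons] at ha ⊢ <;> tauto

/-- Dropping the interior points of a monotone stretch is harmless by `clip_clip_add`, so the stack
of extrema yields the same state and variation as the raw samples. -/
theorem stop_pushExtremum {h σ : ℝ} (hσ : σ ∈ Icc 0 h) (a : ℝ) (s : List ℝ) (x : ℝ) :
    stopState h σ (pushExtremum (a :: s) x) = clip h (stopState h σ (a :: s) + (x - a)) ∧
      stopVar h σ (pushExtremum (a :: s) x) = stopVar h σ (a :: s) +
        |clip h (stopState h σ (a :: s) + (x - a)) - stopState h σ (a :: s)| := by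
  have fix : x = a → clip h (stopState h σ (a :: s) + (x - a)) = stopState h σ (a :: s) := by
    rintro rfl
    obtain ⟨h0, h1⟩ := stopState_mem hσ (x :: s)
    rw [sub_self, add_zero, clip, min_eq_right h1, max_eq_right h0]
  match s, fix with
  | [], fix =>
    simp only [pushExtremum]
    split_ifs with hxa
    · rw [fix hxa]; simp
    · exact ⟨rfl, rfl⟩
  | b :: s, fix =>
    simp only [pushExtremum]
    split_ifs with hxa hm
    · rw [fix hxa]; simp
    · have key := clip_clip_add (p := a - b) (q := x - a) (stopState_mem hσ (b :: s))
        (by rcases hm with hm | hm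
            · exact Or.inl ⟨by linarith, by linarith⟩
            · exact Or.inr ⟨by linarith, by linarith⟩)
      rw [show a - b + (x - a) = x - b by ring] at key
      simp only [stopState, stopVar]
      exact ⟨key.1.symm, by linarith [key.2]⟩
    · exact ⟨rfl, rfl⟩

theorem sum_swings_pushExtremum (a : ℝ) (s : List ℝ) (x : ℝ) :
    (swings (pushExtremum (a :: s) x)).sum = (swings (a :: s)).sum + |x - a| := by
  match s with
  | [] =>
    simp only [pushExtremum]
    split_ifs with hxa <;> simp [swings, hxa]
  | b :: s =>
    simp only [pushExtremum]
    split_ifs with hxa hm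
    · simp [hxa]
    · simp only [swings, List.sum_cons]
      rcases hm with hm | hm
      · rw [abs_of_pos (by linarith : 0 < x - b), abs_of_pos (by linarith : 0 < a - b),
          abs_of_pos (by linarith : 0 < x - a)]
        ring
      · rw [abs_of_neg (by linarith : x - b < 0), abs_of_neg (by linarith : a - b < 0),
          abs_of_neg (by linarith : x - a < 0)]
        ring
    · simp only [swings, List.sum_cons]
      ring

/-! ### Profiles -/

/-- Stack of the extrema of the profile `x 0, …, x T`. -/
def extremaStack (x : ℕ → ℝ) (T : ℕ) : List ℝ :=
  ((List.range (T + 1)).map x).foldl pushExtremum []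

theorem extremaStack_zero (x : ℕ → ℝ) : extremaStack x 0 = [x 0] := rfl

theorem extremaStack_succ (x : ℕ → ℝ) (T : ℕ) :
    extremaStack x (T + 1) = pushExtremum (extremaStack x T) (x (T + 1)) := by
  rw [extremaStack, List.range_succ, List.map_append, List.foldl_append]
  rfl

theorem zigzag_extremaStack (x : ℕ → ℝ) (T : ℕ) : Zigzag (extremaStack x T) := by
  induction T with
  | zero => trivial
  | succ T ih => rw [extremaStack_succ]; exact zigzag_pushExtremum ih _

theorem exists_extremaStack_eq_cons (x : ℕ → ℝ) (T : ℕ) :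
    ∃ s, extremaStack x T = x T :: s := by
  cases T with
  | zero => exact ⟨[], rfl⟩
  | succ T =>
    rw [extremaStack_succ]
    exact List.head?_eq_some_iff.1 (head?_pushExtremum _ _)

theorem exists_of_mem_extremaStack {x : ℕ → ℝ} {T : ℕ} {a : ℝ} (ha : a ∈ extremaStack x T) :
    ∃ t ≤ T, a = x t := by
  induction T with
  | zero => exact ⟨0, le_rfl, by simpa [extremaStack_zero] using ha⟩
  | succ T ih =>
    rw [extremaStack_succ] at ha
    rcases mem_pushExtremum ha with ha | ha
    · exact ⟨T + 1, le_rfl, ha⟩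
    · obtain ⟨t, ht, e⟩ := ih ha
      exact ⟨t, by omega, e⟩

/-- The stop operator of width `h`, started at `σ`, along the profile `x`. -/
def stopAlong (h σ : ℝ) (x : ℕ → ℝ) : ℕ → ℝ
  | 0 => σ
  | t + 1 => clip h (stopAlong h σ x t + (x (t + 1) - x t))

theorem stop_mem {h σ : ℝ} (hσ : σ ∈ Icc 0 h) (x : ℕ → ℝ) : ∀ t, stopAlong h σ x t ∈ Icc 0 h
  | 0 => hσ
  | _ + 1 => ⟨clip_nonneg _ _, clip_le (hσ.1.trans hσ.2) _⟩

theorem stop_extremaStack {h σ : ℝ} (hσ : σ ∈ Icc 0 h) (x : ℕ → ℝ) (T : ℕ) :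
    stopState h σ (extremaStack x T) = stopAlong h σ x T ∧
      stopVar h σ (extremaStack x T) =
        ∑ t ∈ Finset.range T, |stopAlong h σ x (t + 1) - stopAlong h σ x t| := by
  induction T with
  | zero => simp [extremaStack_zero, stopState, stopVar, stopAlong]
  | succ T ih =>
    rw [extremaStack_succ, Finset.sum_range_succ, ← ih.2]
    obtain ⟨s, hs⟩ := exists_extremaStack_eq_cons x T
    rw [hs] at ih ⊢
    have := stop_pushExtremum hσ (x T) s (x (T + 1))
    rw [ih.1] at this
    exact this

theorem sum_swings_extremaStack (x : ℕ → ℝ) (T : ℕ) :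
    (swings (extremaStack x T)).sum = ∑ t ∈ Finset.range T, |x (t + 1) - x t| := by
  induction T with
  | zero => simp [extremaStack_zero, swings]
  | succ T ih =>
    rw [extremaStack_succ, Finset.sum_range_succ, ← ih]
    obtain ⟨s, hs⟩ := exists_extremaStack_eq_cons x T
    rw [hs, sum_swings_pushExtremum]

/-! ### Comparison of a profile with a greedy one -/

/-- Distance of the increment `δ` to the increments between `0` and `ρ`. -/
def excess (ρ δ : ℝ) : ℝ := max 0 (max (δ - max ρ 0) (min ρ 0 - δ))

theorem clip_add_sub_mem {h y : ℝ} (hy : y ∈ Icc 0 h) (δ : ℝ) :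
    clip h (y + δ) - y ∈ Icc (min δ 0) (max δ 0) := by
  obtain ⟨h0, h1⟩ := hy
  simp only [clip, min_def, max_def, mem_Icc]
  constructor <;> split_ifs <;> linarith

/-- Here `y` is the competitor's state, `z` the greedy one, and `|z - y|` the potential. A
competitor moving within the signal loses in distance what it gains in variation. A move outside it
by `e` can add `e` to both, hence the factor 2. -/
theorem coupling_up {h y y' z z' ρ e : ℝ} (hy' : y' ∈ Icc 0 h) (hz : z ∈ Icc 0 h)
    (hρ : 0 ≤ ρ) (he : 0 ≤ e) (h1 : -e ≤ y' - y) (h2 : y' - y ≤ ρ + e)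
    (hgreedy : z' = z + ρ ∨ z' = h) :
    |y' - y| + |z' - y'| ≤ |z' - z| + |z - y| + 2 * e := by
  rcases hgreedy with rfl | rfl
  · have a1 : |z + ρ - y'| ≤ |z - y| + |ρ - (y' - y)| := by
      rw [show z + ρ - y' = (z - y) + (ρ - (y' - y)) by ring]
      exact abs_add_le _ _
    have a2 : |y' - y| + |ρ - (y' - y)| ≤ ρ + 2 * e := by
      rcases abs_cases (y' - y) with ⟨k, _⟩ | ⟨k, _⟩ <;>
      rcases abs_cases (ρ - (y' - y)) with ⟨k', _⟩ | ⟨k', _⟩ <;> linarith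
    rw [show z + ρ - z = ρ by ring, abs_of_nonneg hρ]
    linarith
  · rw [abs_of_nonneg (sub_nonneg.2 hy'.2), abs_of_nonneg (sub_nonneg.2 hz.2)]
    rcases abs_cases (y' - y) with ⟨k, _⟩ | ⟨k, _⟩ <;> linarith [le_abs_self (z - y)]

theorem coupling_step {h y z z' ρ δ : ℝ} (hy : y ∈ Icc 0 h) (hz : z ∈ Icc 0 h)
    (hup : 0 ≤ ρ → z' = z + ρ ∨ z' = h) (hdown : ρ < 0 → z' = z + ρ ∨ z' = 0) :
    |clip h (y + δ) - y| + |z' - clip h (y + δ)| ≤ |z' - z| + |z - y| + 2 * excess ρ δ := by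
  have hh := hy.1.trans hy.2
  have hy' : clip h (y + δ) ∈ Icc 0 h := ⟨clip_nonneg _ _, clip_le hh _⟩
  obtain ⟨m1, m2⟩ := clip_add_sub_mem hy δ
  set y' := clip h (y + δ)
  have e0 : 0 ≤ excess ρ δ := le_max_left _ _
  have e1 : δ - max ρ 0 ≤ excess ρ δ := (le_max_left _ _).trans (le_max_right _ _)
  have e2 : min ρ 0 - δ ≤ excess ρ δ := (le_max_right _ _).trans (le_max_right _ _)
  rcases le_or_gt 0 ρ with hρ | hρ
  · rw [max_eq_left hρ] at e1
    rw [min_eq_right hρ] at e2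
    refine coupling_up hy' hz hρ e0 (le_trans (le_min ?_ ?_) m1)
      (m2.trans (max_le ?_ ?_)) (hup hρ) <;> linarith
  · rw [max_eq_right hρ.le] at e1
    rw [min_eq_left hρ.le] at e2
    -- Falling signals reduce to rising ones by the reflection `y ↦ h - y`.
    have key := coupling_up (h := h) (y := h - y) (y' := h - y') (z := h - z) (z' := h - z')
      (ρ := -ρ) (e := excess ρ δ) ⟨by linarith [hy'.2], by linarith [hy'.1]⟩
      ⟨by linarith [hz.2], by linarith [hz.1]⟩ (by linarith) e0 ?_ ?_ ?_
    · simp only [sub_sub_sub_cancel_left] at key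
      rw [abs_sub_comm y', abs_sub_comm z' y', abs_sub_comm z' z, abs_sub_comm z y]
      exact key
    · have : y' - y ≤ excess ρ δ := m2.trans (max_le (by linarith) e0)
      linarith
    · have : ρ - excess ρ δ ≤ y' - y := le_trans (le_min (by linarith) (by linarith)) m1
      linarith
    · rcases hdown hρ with k | k
      · exact Or.inl (by linarith)
      · exact Or.inr (by linarith)

/-- Among all profiles, one whose stop operator follows the signal `ρ` greedily has the largest
variation of the stop operator, up to the excess over the signal. -/
theorem sum_stop_le_of_greedy {h σ : ℝ} (hσ : σ ∈ Icc 0 h) (x g ρ : ℕ → ℝ) (T : ℕ)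
    (hg : ∀ t < T,
      (0 ≤ ρ t → stopAlong h σ g (t + 1) = stopAlong h σ g t + ρ t ∨ stopAlong h σ g (t + 1) = h) ∧
      (ρ t < 0 → stopAlong h σ g (t + 1) = stopAlong h σ g t + ρ t ∨ stopAlong h σ g (t + 1) = 0)) :
    ∑ t ∈ Finset.range T, |stopAlong h σ x (t + 1) - stopAlong h σ x t| ≤
      ∑ t ∈ Finset.range T, |stopAlong h σ g (t + 1) - stopAlong h σ g t| +
        2 * ∑ t ∈ Finset.range T, excess (ρ t) (x (t + 1) - x t) := by
  -- The potential is added to the claim to make the induction close; it vanishes at the start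
  -- because both operators begin at `σ`.
  suffices H : ∑ t ∈ Finset.range T, |stopAlong h σ x (t + 1) - stopAlong h σ x t| +
      |stopAlong h σ g T - stopAlong h σ x T| ≤
      ∑ t ∈ Finset.range T, |stopAlong h σ g (t + 1) - stopAlong h σ g t| +
        2 * ∑ t ∈ Finset.range T, excess (ρ t) (x (t + 1) - x t) by
    linarith [abs_nonneg (stopAlong h σ g T - stopAlong h σ x T)]
  induction T with
  | zero => simp [stopAlong]
  | succ T ih =>
    have ih := ih fun t ht => hg t (by omega)
    have step := coupling_step (δ := x (T + 1) - x T) (stop_mem hσ x T) (stop_mem hσ g T)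
      (hg T (by omega)).1 (hg T (by omega)).2
    simp only [Finset.sum_range_succ]
    change |stopAlong h σ x (T + 1) - _| + |_ - stopAlong h σ x (T + 1)| ≤ _ at step
    linarith

theorem sum_min_halfCycles_le_of_greedy {h σ : ℝ} (hσ : σ ∈ Icc 0 h) (x g ρ : ℕ → ℝ) (T : ℕ)
    (hg : ∀ t < T,
      (0 ≤ ρ t → stopAlong h σ g (t + 1) = stopAlong h σ g t + ρ t ∨ stopAlong h σ g (t + 1) = h) ∧
      (ρ t < 0 → stopAlong h σ g (t + 1) = stopAlong h σ g t + ρ t ∨ stopAlong h σ g (t + 1) = 0)) :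
    ((halfCycles (extremaStack x T)).map fun u => min u h).sum ≤
      ((halfCycles (extremaStack g T)).map fun u => min u h).sum + h +
        2 * ∑ t ∈ Finset.range T, excess (ρ t) (x (t + 1) - x t) := by
  have h1 := sum_halfCycles_le_stopVar hσ (zigzag_extremaStack x T)
  have h2 := stopVar_le_sum_halfCycles hσ (zigzag_extremaStack g T)
  have h3 := sum_stop_le_of_greedy hσ x g ρ T hg
  rw [(stop_extremaStack hσ x T).2] at h1
  rw [(stop_extremaStack hσ g T).2] at h2
  linarith

/-! ### Majorization -/

/-- Chord slopes of a concave function decrease. This keeps `f` monotone up to `a` after the slope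
of its last chord has been subtracted. -/
theorem slope_mul_sub_le_of_concaveOn {f : ℝ → ℝ} (hf : ConcaveOn ℝ (Ici 0) f) {p q a m : ℝ}
    (hp : 0 ≤ p) (hpq : p ≤ q) (hqa : q ≤ a) (ham : a < m) :
    (f m - f a) / (m - a) * (q - p) ≤ f q - f p := by
  rcases hpq.eq_or_lt with rfl | hpq
  · simp
  rw [← le_div_iff₀ (sub_pos.2 hpq)]
  have hm : m ∈ Ici (0 : ℝ) := by simp only [mem_Ici]; linarith
  rcases hqa.eq_or_lt with rfl | hqa
  · exact hf.slope_anti_adjacent hp hm hpq ham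
  · exact (hf.slope_anti_adjacent (mem_Ici.2 (hp.trans hpq.le)) hm hqa ham).trans
      (hf.slope_anti_adjacent hp (mem_Ici.2 (by linarith)) hpq hqa)

/-- On a finite set of positive reals, a concave nondecreasing function is a nonnegative
combination of the functions `min · h`. -/
theorem exists_eq_sum_min (S : Finset ℝ) : ∀ (f : ℝ → ℝ) (κ : ℝ), (∀ p ∈ S, 0 < p) →
    ConcaveOn ℝ (Ici 0) f → f 0 = 0 → 0 ≤ κ → (∀ p ∈ S, f p ≤ κ * p) →
    (∀ p q, 0 ≤ p → p ≤ q → q ∈ S → f p ≤ f q) →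
    ∃ c : ℝ → ℝ, (∀ h ∈ S, 0 ≤ c h) ∧ ∑ h ∈ S, c h ≤ κ ∧
      ∀ p ∈ S, f p = ∑ h ∈ S, c h * min p h := by
  induction S using Finset.induction_on_max with
  | empty => exact fun f κ _ _ _ hκ _ _ => ⟨0, by simp, by simpa, by simp⟩
  | insert m S hm ih =>
    intro f κ hpos hf hf0 hκ hle hmono
    have hmS : m ∉ S := fun h => lt_irrefl _ (hm m h)
    obtain ⟨a, ha0, ham, hSa, ha⟩ :
        ∃ a, 0 ≤ a ∧ a < m ∧ (∀ h ∈ S, h ≤ a) ∧ (a ∈ S ∨ a = 0 ∧ S = ∅) := by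
      rcases S.eq_empty_or_nonempty with rfl | hne
      · exact ⟨0, le_rfl, hpos m (by simp), by simp, Or.inr ⟨rfl, rfl⟩⟩
      · have hmem := S.max'_mem hne
        exact ⟨S.max' hne, (hpos _ (by simp [hmem])).le, hm _ hmem, fun h hh => S.le_max' h hh,
          Or.inl hmem⟩
    have hma : 0 < m - a := sub_pos.2 ham
    -- The slope of the last chord becomes the weight of `min · m`. Since `min p m = p` for the
    -- remaining points `p`, the induction continues with `f p - s * p` and the budget `κ - s`.
    set s := (f m - f a) / (m - a) with hs
    have hsm : s * (m - a) = f m - f a := div_mul_cancel₀ _ hma.ne'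
    have hs0 : 0 ≤ s :=
      div_nonneg (sub_nonneg.2 (hmono a m ha0 ham.le (by simp))) hma.le
    have hsκ : s ≤ κ := by
      rcases ha with ha | ⟨rfl, -⟩
      · have hap := hpos a (by simp [ha])
        have k1 := slope_mul_sub_le_of_concaveOn hf (le_refl 0) ha0 le_rfl ham
        have k2 := hle a (by simp [ha])
        rw [← hs, hf0, sub_zero, sub_zero] at k1
        exact le_of_mul_le_mul_right (k1.trans k2) hap
      · have k2 := hle m (by simp)
        rw [sub_zero, hf0, sub_zero] at hsm
        rw [← hsm] at k2
        exact le_of_mul_le_mul_right k2 (by linarith)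
    obtain ⟨c, hc0, hcs, hc⟩ := ih (fun p => f p - s * p) (κ - s)
      (fun p hp => hpos p (by simp [hp]))
      (by
        have := hf.sub ((convexOn_id (convex_Ici (0 : ℝ))).smul hs0)
        exact this)
      (by simp [hf0]) (sub_nonneg.2 hsκ)
      (fun p hp => by have := hle p (by simp [hp]); linarith)
      (fun p q hp hpq hq => by
        have := slope_mul_sub_le_of_concaveOn hf hp hpq (hSa q hq) ham
        rw [← hs] at this
        linarith)
    have hca : f a - s * a = ∑ h ∈ S, c h * h := by
      rcases ha with ha | ⟨rfl, rfl⟩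
      · rw [hc a ha]
        exact Finset.sum_congr rfl fun h hh => by rw [min_eq_right (hSa h hh)]
      · simp [hf0]
    have hne : ∀ h ∈ S, h ≠ m := fun h hh => (hm h hh).ne
    refine ⟨fun h => if h = m then s else c h, ?_, ?_, ?_⟩
    · intro h hh
      dsimp only
      split_ifs with e
      · exact hs0
      · exact hc0 h (by simpa [e] using hh)
    · rw [Finset.sum_insert hmS, if_pos rfl,
        Finset.sum_congr rfl fun h hh => if_neg (hne h hh)]
      linarith
    · intro p hp
      rw [Finset.sum_insert hmS]
      dsimp only
      rw [if_pos rfl, Finset.sum_congr rfl fun h hh => by rw [if_neg (hne h hh)]]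
      rcases Finset.mem_insert.1 hp with rfl | hp
      · rw [min_self, Finset.sum_congr rfl fun h hh => by rw [min_eq_right (hm h hh).le], ← hca]
        linarith
      · rw [min_eq_left (hm p hp).le, ← hc p hp]
        ring

theorem sum_map_sum_min (S : Finset ℝ) (c f : ℝ → ℝ) (U : List ℝ)
    (hU : ∀ u ∈ U, f u = ∑ h ∈ S, c h * min u h) :
    (U.map f).sum = ∑ h ∈ S, c h * (U.map fun u => min u h).sum := by
  induction U with
  | nil => simp
  | cons u U ih =>
    simp only [List.forall_mem_cons] at hU
    simp only [List.map_cons, List.sum_cons, mul_add, Finset.sum_add_distrib, ih hU.2, hU.1]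

/-- Comparing the sums of all truncations `min · h` compares the sums of a concave function. -/
theorem sum_map_le_of_sum_min_le {f : ℝ → ℝ} {H κ C : ℝ} (hf : ConcaveOn ℝ (Ici 0) f)
    (hf0 : f 0 = 0) (hκ : 0 ≤ κ) (hC : 0 ≤ C) (hle : ∀ p, 0 ≤ p → f p ≤ κ * p)
    (hmono : MonotoneOn f (Icc 0 H)) {U V : List ℝ} (hU : ∀ u ∈ U, u ∈ Icc 0 H)
    (hV : ∀ u ∈ V, u ∈ Icc 0 H)
    (h : ∀ h ∈ Icc 0 H,
      (U.map fun u => min u h).sum ≤ (V.map fun u => min u h).sum + C) :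
    (U.map f).sum ≤ (V.map f).sum + κ * C := by
  -- Zero depths contribute nothing to either side, while `exists_eq_sum_min` needs positive points.
  set S := (U ++ V).toFinset.filter (0 < ·) with hS
  have hmem : ∀ u ∈ S, u ∈ Icc 0 H := fun u hu => by
    simp only [hS, Finset.mem_filter, List.mem_toFinset, List.mem_append] at hu
    exact hu.1.elim (hU u) (hV u)
  obtain ⟨c, hc0, hcs, hc⟩ := exists_eq_sum_min S f κ
    (fun p hp => (Finset.mem_filter.1 hp).2) hf hf0 hκ (fun p hp => hle p (hmem p hp).1)
    (fun p q hp hpq hq => hmono ⟨hp, hpq.trans (hmem q hq).2⟩ (hmem q hq) hpq)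
  have hc' : ∀ u ∈ U ++ V, f u = ∑ h ∈ S, c h * min u h := by
    intro u hu
    have h0 : 0 ≤ u := (List.mem_append.1 hu).elim (fun k => (hU u k).1) fun k => (hV u k).1
    rcases h0.eq_or_lt with rfl | h0
    · rw [hf0, Finset.sum_eq_zero]
      intro h hh
      rw [min_eq_left (hmem h hh).1, mul_zero]
    · exact hc u (by simp [hS, h0, List.mem_append.1 hu])
  rw [sum_map_sum_min S c f U fun u hu => hc' u (by simp [hu]),
    sum_map_sum_min S c f V fun u hu => hc' u (by simp [hu])]
  calc ∑ h ∈ S, c h * (U.map fun u => min u h).sum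
      ≤ ∑ h ∈ S, c h * ((V.map fun u => min u h).sum + C) :=
        Finset.sum_le_sum fun k hk => mul_le_mul_of_nonneg_left (h k (hmem k hk)) (hc0 k hk)
    _ = ∑ h ∈ S, c h * (V.map fun u => min u h).sum + (∑ h ∈ S, c h) * C := by
        simp only [mul_add, Finset.sum_add_distrib, Finset.sum_mul]
    _ ≤ _ := by linarith [mul_le_mul_of_nonneg_right hcs hC]

/-! ### Excess over the signal and the deviation penalty -/

theorem excess_of_nonneg {ρ δ : ℝ} (h0 : 0 ≤ δ) (h1 : δ ≤ ρ) : excess ρ δ = 0 := by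
  rw [excess, max_eq_left (h0.trans h1), min_eq_right (h0.trans h1)]
  exact max_eq_left (max_le (by linarith) (by linarith))

theorem excess_of_nonpos {ρ δ : ℝ} (h0 : δ ≤ 0) (h1 : ρ ≤ δ) : excess ρ δ = 0 := by
  rw [excess, max_eq_right (h1.trans h0), min_eq_left (h1.trans h0)]
  exact max_eq_left (max_le (by linarith) (by linarith))

theorem excess_mul {a : ℝ} (ha : 0 ≤ a) (ρ δ : ℝ) : excess (a * ρ) (a * δ) = a * excess ρ δ := by
  have h1 : max (a * ρ) 0 = a * max ρ 0 := by rw [mul_max_of_nonneg _ _ ha, mul_zero]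
  have h2 : min (a * ρ) 0 = a * min ρ 0 := by rw [mul_min_of_nonneg _ _ ha, mul_zero]
  rw [excess, excess, h1, h2, ← mul_sub, ← mul_sub, mul_max_of_nonneg _ _ ha,
    mul_max_of_nonneg _ _ ha, mul_zero]

/-- The deviation penalty, as the penalty for doing nothing, minus the savings of the action as if
it were within the signal, plus a correction for the excess over the signal. -/
theorem deviation_eq (θ π r p : ℝ) :
    θ * max (r - p) 0 + π * max (p - r) 0 =
      θ * max r 0 + π * max (-r) 0 - ((θ + π) / 2 * |p| + (θ - π) / 2 * p) +
        (θ + π) * excess r p := by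
  have key : ∀ e, excess r p = e → max (r - p) 0 = max r 0 - (|p| + p) / 2 + e →
      max (p - r) 0 = max (-r) 0 - (|p| - p) / 2 + e →
      θ * max (r - p) 0 + π * max (p - r) 0 =
        θ * max r 0 + π * max (-r) 0 - ((θ + π) / 2 * |p| + (θ - π) / 2 * p) +
          (θ + π) * excess r p := by
    rintro e rfl h1 h2
    rw [h1, h2]
    ring
  refine key _ rfl ?_ ?_ <;> simp only [excess, max_def, min_def, abs] <;> split_ifs <;> linarith

/-! ### The online policy -/

/-- Bounds on the state `z` of the stop operator of width `h` along a profile in `[lo, hi]` with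
current value `x`, running maximum `M` and running minimum `m`. -/
structure StopBounds (h lo hi x M m z : ℝ) : Prop where
  le_of_max : min h (M - m) - (M - x) ≤ z
  le_of_min : z ≤ h - (min h (M - m) - (x - m))
  le_of_hi : h - (hi - x) ≤ z
  le_of_lo : z ≤ x - lo

theorem le_clip {h z w : ℝ} (h1 : w ≤ h) (h2 : w ≤ z) : w ≤ clip h z :=
  (le_min h1 h2).trans (le_max_right _ _)

/-- At `x = M` the first bound says that the stop operator is saturated at `h` once the range `M -
m` reaches `h`; at `x = hi` the third says that it is at `h`. The other two play the same role at
the bottom. A new extremum widens the range by no more than the part of the increment beyond the old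
one, so the bounds survive the step. -/
theorem StopBounds.step {h lo hi x M m z x' : ℝ} (hb : StopBounds h lo hi x M m z) (hh : 0 ≤ h)
    (hm : m ≤ x) (hM : x ≤ M) (hx' : x' ∈ Icc lo hi) :
    StopBounds h lo hi x' (max M x') (min m x') (clip h (z + (x' - x))) := by
  obtain ⟨b1, b2, b3, b4⟩ := hb
  obtain ⟨l, r⟩ := hx'
  refine ⟨?_, ?_, le_clip (by linarith) (by linarith),
    max_le (by linarith) ((min_le_right _ _).trans (by linarith))⟩
  · rcases le_total x' m with k | k
    · refine le_trans ?_ (clip_nonneg _ _)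
      rw [max_eq_left (by linarith), min_eq_right k]
      linarith [min_le_right h (M - x')]
    · rw [min_eq_left k]
      rcases le_total x' M with k' | k'
      · rw [max_eq_left k']
        exact le_clip (by linarith [min_le_left h (M - m)]) (by linarith)
      · rw [max_eq_right k', sub_self, sub_zero]
        refine le_clip (min_le_left _ _) ?_
        have : min h (x' - m) ≤ min h (M - m) + (x' - M) := by
          rw [← min_add_add_right]
          exact min_le_min (by linarith) (by linarith)
        linarith
  · rcases le_total M x' with k | k
    · refine (clip_le hh _).trans ?_
      rw [max_eq_right k]
      linarith [min_le_right h (x' - min m x')]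
    · rw [max_eq_left k]
      rcases le_total m x' with k' | k'
      · rw [min_eq_left k']
        exact max_le (by linarith [min_le_left h (M - m)])
          ((min_le_right _ _).trans (by linarith))
      · rw [min_eq_right k', sub_self, sub_zero]
        refine max_le (by linarith [min_le_left h (M - x')]) ((min_le_right _ _).trans ?_)
        have : min h (M - x') ≤ min h (M - m) + (m - x') := by
          rw [← min_add_add_right]
          exact min_le_min (by linarith) (by linarith)
        linarith

namespace Battery

variable (b : Battery)

/-- Change of the state of charge that the instruction `r` asks for. -/
def signalStep (r : ℝ) : ℝ := b.next 0 (max r 0) (max (-r) 0)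

theorem chargeRate_pos : 0 < b.τ * b.ηc / b.E :=
  div_pos (mul_pos b.τ_pos b.ηc_pos) b.E_pos

theorem dischargeRate_pos : 0 < b.τ / (b.ηd * b.E) :=
  div_pos b.τ_pos (mul_pos b.ηd_pos b.E_pos)

theorem signalStep_of_nonneg {r : ℝ} (hr : 0 ≤ r) :
    b.signalStep r = b.τ * b.ηc / b.E * r := by
  rw [signalStep, next, max_eq_left hr, max_eq_right (by linarith)]
  ring

theorem signalStep_of_nonpos {r : ℝ} (hr : r ≤ 0) :
    b.signalStep r = b.τ / (b.ηd * b.E) * r := by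
  rw [signalStep, next, max_eq_right hr, max_eq_left (by linarith)]
  ring

theorem signalStep_nonneg {r : ℝ} (hr : 0 ≤ r) : 0 ≤ b.signalStep r := by
  rw [b.signalStep_of_nonneg hr]
  exact mul_nonneg b.chargeRate_pos.le hr

theorem signalStep_neg {r : ℝ} (hr : r < 0) : b.signalStep r < 0 := by
  rw [b.signalStep_of_nonpos hr.le]
  exact mul_neg_of_pos_of_neg b.dischargeRate_pos hr

theorem soc_onlineActions (x₀ : ℝ) (r : ℕ → ℝ) : ∀ t,
    b.soc x₀ (b.onlineActions x₀ r).1 (b.onlineActions x₀ r).2 t = (b.controller x₀ r t).x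
  | 0 => rfl
  | t + 1 => by
    rw [soc, soc_onlineActions x₀ r t]
    rfl

theorem policyStep_x_of_nonneg (s : Controller) {r : ℝ} (hr : 0 ≤ r) :
    (b.policyStep s r).x = min (b.upperBound s) (s.x + b.signalStep r) := by
  have hτ := b.τ_pos.ne'
  have hc := b.ηc_pos.ne'
  have hE := b.E_pos.ne'
  change b.next s.x (b.policyCharge s r) (b.policyDischarge s r) = _
  rw [policyCharge, policyDischarge, if_pos hr, if_pos hr, next,
    mul_min_of_nonneg _ _ b.chargeRate_pos.le, ← b.signalStep_of_nonneg hr, mul_zero, sub_zero,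
    ← min_add_add_left]
  congr 1
  field_simp
  ring

theorem policyStep_x_of_neg (s : Controller) {r : ℝ} (hr : r < 0) :
    (b.policyStep s r).x = max (b.lowerBound s) (s.x + b.signalStep r) := by
  have hτ := b.τ_pos.ne'
  have hd := b.ηd_pos.ne'
  have hE := b.E_pos.ne'
  change b.next s.x (b.policyCharge s r) (b.policyDischarge s r) = _
  rw [policyCharge, policyDischarge, if_neg hr.not_ge, if_neg hr.not_ge, next,
    mul_min_of_nonneg _ _ b.dischargeRate_pos.le, b.signalStep_of_nonpos hr.le, mul_zero,
    add_zero, sub_eq_add_neg, ← max_neg_neg, ← max_add_add_left]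
  congr 1
  · field_simp
    ring
  · ring

/-! ### Invariants of the policy and greediness of its stop operator -/

/-- What the policy guarantees about its state. -/
structure Controller.Admissible (s : Controller) : Prop where
  lo_le : b.xlo ≤ s.xmin
  min_le : s.xmin ≤ s.x
  le_max : s.x ≤ s.xmax
  le_hi : s.xmax ≤ b.xhi
  range_le : s.xmax - s.xmin ≤ b.threshold

variable {b}

theorem Controller.Admissible.le_upperBound {s : Controller} (hs : s.Admissible b) :
    s.x ≤ b.upperBound s :=
  _root_.le_min (hs.le_max.trans hs.le_hi) (by linarith [hs.le_max, hs.range_le])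

theorem Controller.Admissible.lowerBound_le {s : Controller} (hs : s.Admissible b) :
    b.lowerBound s ≤ s.x :=
  _root_.max_le (hs.lo_le.trans hs.min_le) (by linarith [hs.min_le, hs.range_le])

theorem Controller.Admissible.step_mem {s : Controller} (hs : s.Admissible b) (r : ℝ) :
    (b.policyStep s r).x ∈ Icc (b.lowerBound s) (b.upperBound s) := by
  have h1 := hs.le_upperBound
  have h2 := hs.lowerBound_le
  rcases le_or_gt 0 r with hr | hr
  · rw [b.policyStep_x_of_nonneg s hr]
    exact ⟨_root_.le_min (h2.trans h1) (by linarith [b.signalStep_nonneg hr]), min_le_left _ _⟩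
  · rw [b.policyStep_x_of_neg s hr]
    exact ⟨le_max_left _ _, _root_.max_le (h2.trans h1) (by linarith [b.signalStep_neg hr])⟩

theorem Controller.Admissible.step {s : Controller} (hs : s.Admissible b) (r : ℝ) :
    (b.policyStep s r).Admissible b := by
  obtain ⟨h1, h2⟩ := hs.step_mem r
  have h3 := h1
  have h4 := h2
  rw [lowerBound, _root_.max_le_iff] at h1
  rw [upperBound, _root_.le_min_iff] at h2
  have hmin : (b.policyStep s r).xmin = min s.xmin (b.policyStep s r).x := rfl
  have hmax : (b.policyStep s r).xmax = max s.xmax (b.policyStep s r).x := rfl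
  refine ⟨?_, ?_, ?_, ?_, ?_⟩
  · rw [hmin]; exact _root_.le_min hs.lo_le h1.1
  · rw [hmin]; exact min_le_right _ _
  · rw [hmax]; exact le_max_right _ _
  · rw [hmax]; exact _root_.max_le hs.le_hi h2.1
  · rw [hmin, hmax]
    have := hs.range_le
    have := hs.min_le
    have := hs.le_max
    rcases max_cases s.xmax (b.policyStep s r).x with ⟨e, _⟩ | ⟨e, _⟩ <;>
    rcases min_cases s.xmin (b.policyStep s r).x with ⟨e', _⟩ | ⟨e', _⟩ <;> rw [e, e'] <;> linarith

theorem admissible_controller {x₀ : ℝ} (hû : 0 ≤ b.threshold) (hx₀ : x₀ ∈ Icc b.xlo b.xhi)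
    (r : ℕ → ℝ) : ∀ t, (b.controller x₀ r t).Admissible b
  | 0 => ⟨hx₀.1, le_rfl, le_rfl, hx₀.2, by simpa [controller] using hû⟩
  | t + 1 => (admissible_controller hû hx₀ r t).step (r t)

theorem xmin_controller_antitone {x₀ : ℝ} (r : ℕ → ℝ) {s t : ℕ} (h : s ≤ t) :
    (b.controller x₀ r t).xmin ≤ (b.controller x₀ r s).xmin :=
  antitone_nat_of_succ_le (f := fun t => (b.controller x₀ r t).xmin)
    (fun _ => _root_.min_le_left _ _) h

theorem xmax_controller_monotone {x₀ : ℝ} (r : ℕ → ℝ) {s t : ℕ} (h : s ≤ t) :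
    (b.controller x₀ r s).xmax ≤ (b.controller x₀ r t).xmax :=
  monotone_nat_of_le_succ (f := fun t => (b.controller x₀ r t).xmax)
    (fun _ => _root_.le_max_left _ _) h

/-- The policy is operable and stays within the signal. -/
theorem onlineActions_mem {x₀ : ℝ} (hû : 0 ≤ b.threshold) (hx₀ : x₀ ∈ Icc b.xlo b.xhi)
    {r : ℕ → ℝ} {T : ℕ} (hr : ∀ t < T, r t ∈ Icc (-b.P) b.P) :
    b.onlineActions x₀ r ∈ b.operable x₀ T ∩ withinSignal r T := by
  have hadm := admissible_controller hû hx₀ r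
  have hC : 0 < b.E / (b.τ * b.ηc) := div_pos b.E_pos (mul_pos b.τ_pos b.ηc_pos)
  have hD : 0 < b.E * b.ηd / b.τ := div_pos (mul_pos b.E_pos b.ηd_pos) b.τ_pos
  have hc : ∀ t, 0 ≤ (b.onlineActions x₀ r).1 t ∧ (b.onlineActions x₀ r).1 t ≤ max (r t) 0 := by
    intro t
    simp only [onlineActions, policyCharge]
    split_ifs with h
    · exact ⟨le_min (mul_nonneg hC.le (sub_nonneg.2 (hadm t).le_upperBound)) h,
        (min_le_right _ _).trans (le_max_left _ _)⟩
    · exact ⟨le_rfl, le_max_right _ _⟩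
  have hd : ∀ t, 0 ≤ (b.onlineActions x₀ r).2 t ∧ (b.onlineActions x₀ r).2 t ≤ max (-r t) 0 := by
    intro t
    simp only [onlineActions, policyDischarge]
    split_ifs with h
    · exact ⟨le_rfl, le_max_right _ _⟩
    · exact ⟨le_min (mul_nonneg hD.le (sub_nonneg.2 (hadm t).lowerBound_le)) (by linarith),
        (min_le_right _ _).trans (le_max_left _ _)⟩
  refine ⟨fun t ht => ?_, fun t _ => ⟨(hc t).2, (hd t).2⟩⟩
  obtain ⟨r1, r2⟩ := hr t ht
  have hP : 0 ≤ b.P := by linarith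
  refine ⟨⟨(hc t).1, (hc t).2.trans (max_le r2 hP)⟩,
    ⟨(hd t).1, (hd t).2.trans (max_le (by linarith) hP)⟩, ?_⟩
  rw [soc_onlineActions]
  have := hadm (t + 1)
  exact ⟨this.lo_le.trans this.min_le, this.le_max.trans this.le_hi⟩

/-- The initial state is the least one in `[0, h]` satisfying `le_of_hi`; the condition `h ≤ xhi -
xlo` makes it satisfy `le_of_lo` as well. -/
theorem stopBounds_controller {x₀ h : ℝ} (hû : 0 ≤ b.threshold) (hx₀ : x₀ ∈ Icc b.xlo b.xhi)
    (h0 : 0 ≤ h) (hhW : h ≤ b.xhi - b.xlo) (r : ℕ → ℝ) (t : ℕ) :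
    StopBounds h b.xlo b.xhi (b.controller x₀ r t).x (b.controller x₀ r t).xmax
      (b.controller x₀ r t).xmin
      (stopAlong h (max 0 (h - (b.xhi - x₀))) (fun t => (b.controller x₀ r t).x) t) := by
  induction t with
  | zero =>
    obtain ⟨l, u⟩ := hx₀
    simp only [controller, stopAlong]
    refine ⟨?_, ?_, le_max_right _ _, max_le (by linarith) (by linarith)⟩
    · rw [sub_self, min_eq_right h0, sub_self]; exact le_max_left _ _
    · rw [sub_self, min_eq_right h0, sub_self, sub_zero]; exact max_le h0 (by linarith)
  | succ t ih =>
    have hadm := admissible_controller hû hx₀ r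
    exact ih.step h0 (hadm t).min_le (hadm t).le_max
      ⟨(hadm (t + 1)).lo_le.trans (hadm (t + 1)).min_le,
        (hadm (t + 1)).le_max.trans (hadm (t + 1)).le_hi⟩

/-- For widths up to the threshold, the stop operator along the profile of the policy follows the
signal greedily. -/
theorem greedy_controller {x₀ h : ℝ} (hû : 0 ≤ b.threshold) (hx₀ : x₀ ∈ Icc b.xlo b.xhi)
    (h0 : 0 ≤ h) (hhW : h ≤ b.xhi - b.xlo) (hhû : h ≤ b.threshold) (r : ℕ → ℝ) {z : ℕ → ℝ}
    (hz : z = stopAlong h (max 0 (h - (b.xhi - x₀))) (fun t => (b.controller x₀ r t).x)) (t : ℕ) :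
    (0 ≤ b.signalStep (r t) → z (t + 1) = z t + b.signalStep (r t) ∨ z (t + 1) = h) ∧
      (b.signalStep (r t) < 0 → z (t + 1) = z t + b.signalStep (r t) ∨ z (t + 1) = 0) := by
  have hσ : max 0 (h - (b.xhi - x₀)) ∈ Icc 0 h :=
    ⟨le_max_left _ _, max_le h0 (by linarith [hx₀.2])⟩
  have hzt : z t ∈ Icc 0 h := hz ▸ stop_mem hσ _ t
  have hzt' : z (t + 1) ∈ Icc 0 h := hz ▸ stop_mem hσ _ (t + 1)
  have hadm := admissible_controller hû hx₀ r t
  have hadm' := admissible_controller hû hx₀ r (t + 1)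
  have hb := stopBounds_controller hû hx₀ h0 hhW r (t + 1)
  rw [← hz] at hb
  have hstep : z (t + 1) = clip h
      (z t + ((b.controller x₀ r (t + 1)).x - (b.controller x₀ r t).x)) := by
    rw [hz]; rfl
  have hmin : (b.controller x₀ r (t + 1)).xmin ≤ (b.controller x₀ r t).xmin :=
    _root_.min_le_left _ _
  have hmax : (b.controller x₀ r t).xmax ≤ (b.controller x₀ r (t + 1)).xmax :=
    _root_.le_max_left _ _
  have hrange := hadm'.range_le
  have hle := hadm'.le_max
  have hge := hadm'.min_le
  obtain ⟨b1, b2, b3, b4⟩ := hb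
  refine ⟨fun hρ => ?_, fun hρ => ?_⟩
  · have hr : 0 ≤ r t := not_lt.1 fun hr => hρ.not_gt (b.signalStep_neg hr)
    have hx' : (b.controller x₀ r (t + 1)).x = _ := b.policyStep_x_of_nonneg _ hr
    rcases min_cases (b.upperBound (b.controller x₀ r t))
        ((b.controller x₀ r t).x + b.signalStep (r t)) with ⟨e, _⟩ | ⟨e, _⟩
    · refine Or.inr (le_antisymm hzt'.2 ?_)
      rw [e, upperBound] at hx'
      -- Held back at `xhi`, saturation is `le_of_hi`. Held back at `xmin + threshold`, the new SoC
      -- is the running maximum and the range equals the threshold, hence is at least `h`, and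
      -- `le_of_max` applies.
      rcases min_cases b.xhi ((b.controller x₀ r t).xmin + b.threshold) with ⟨e', _⟩ | ⟨e', _⟩
      · linarith
      · have : h ≤ min h ((b.controller x₀ r (t + 1)).xmax - (b.controller x₀ r (t + 1)).xmin) :=
          le_min le_rfl (by linarith)
        linarith
    · rw [e] at hx'
      rw [hstep, hx', add_sub_cancel_left, clip_of_nonneg h0 (add_nonneg hzt.1 hρ)]
      rcases min_cases h (z t + b.signalStep (r t)) with ⟨e', _⟩ | ⟨e', _⟩
      exacts [Or.inr e', Or.inl e']
  · have hr : r t < 0 := not_le.1 fun hr => hρ.not_ge (b.signalStep_nonneg hr)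
    have hx' : (b.controller x₀ r (t + 1)).x = _ := b.policyStep_x_of_neg _ hr
    rcases max_cases (b.lowerBound (b.controller x₀ r t))
        ((b.controller x₀ r t).x + b.signalStep (r t)) with ⟨e, _⟩ | ⟨e, _⟩
    · refine Or.inr (le_antisymm ?_ hzt'.1)
      rw [e, lowerBound] at hx'
      rcases max_cases b.xlo ((b.controller x₀ r t).xmax - b.threshold) with ⟨e', _⟩ | ⟨e', _⟩
      · linarith
      · have : h ≤ min h ((b.controller x₀ r (t + 1)).xmax - (b.controller x₀ r (t + 1)).xmin) :=
          le_min le_rfl (by linarith)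
        linarith
    · rw [e] at hx'
      rw [hstep, hx', add_sub_cancel_left, clip_of_le (by linarith [hzt.2])]
      rcases max_cases 0 (z t + b.signalStep (r t)) with ⟨e', _⟩ | ⟨e', _⟩
      exacts [Or.inr e', Or.inl e']

/-! ### The cost in terms of half cycles -/

variable (b)

/-- Net saving from a half cycle of depth `u`, in units of half the price of a life. -/
def saving (u : ℝ) : ℝ := b.marginalPrice * u - b.Φ u

theorem marginalPrice_nonneg : 0 ≤ b.marginalPrice :=
  div_nonneg (add_nonneg (mul_nonneg b.π_nonneg b.ηd_pos.le) (div_nonneg b.θ_nonneg b.ηc_pos.le))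
    b.B_pos.le

/-- The penalty in one step, in terms of the change of the state of charge. -/
def StepPenaltyEq (c d r : ℝ) : Prop :=
  b.τ * (b.θ * max (r - (c - d)) 0 + b.π * max ((c - d) - r) 0) =
    b.τ * (b.θ * max r 0 + b.π * max (-r) 0) -
      b.E * (b.B * b.marginalPrice / 2 * |b.next 0 c d| +
        (b.θ / b.ηc - b.π * b.ηd) / 2 * b.next 0 c d) +
      b.E * b.B * b.marginalPrice * excess (b.signalStep r) (b.next 0 c d)

theorem B_mul_marginalPrice : b.B * b.marginalPrice = b.π * b.ηd + b.θ / b.ηc :=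
  mul_div_cancel₀ _ b.B_pos.ne'

theorem next_sub (x c d : ℝ) : b.next x c d - x = b.next 0 c d := by
  simp only [next]; ring

variable {b}

/-- Within the signal one of `c`, `d` vanishes, so the change of SoC determines the power. A unit of
SoC saves `E * θ / ηc` when charged and `E * π * ηd` when discharged; their mean multiplies the
absolute change and half their difference the signed one. -/
theorem excess_eq_zero_and_stepPenaltyEq {c d r : ℝ} (hc : 0 ≤ c) (hd : 0 ≤ d)
    (hcr : c ≤ max r 0) (hdr : d ≤ max (-r) 0) :
    excess (b.signalStep r) (b.next 0 c d) = 0 ∧ b.StepPenaltyEq c d r := by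
  have hE := b.E_pos.ne'
  have hηc := b.ηc_pos.ne'
  have hηd := b.ηd_pos.ne'
  rcases le_total 0 r with hr | hr
  · rw [max_eq_right (by linarith : -r ≤ 0)] at hdr
    rw [max_eq_left hr] at hcr
    obtain rfl : d = 0 := le_antisymm hdr hd
    have hn : b.next 0 c 0 = b.τ * b.ηc / b.E * c := by simp [next]
    have hn0 : 0 ≤ b.next 0 c 0 := hn ▸ mul_nonneg b.chargeRate_pos.le hc
    have he : excess (b.signalStep r) (b.next 0 c 0) = 0 := by
      refine excess_of_nonneg hn0 ?_
      rw [hn, b.signalStep_of_nonneg hr]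
      exact mul_le_mul_of_nonneg_left hcr b.chargeRate_pos.le
    refine ⟨he, ?_⟩
    rw [StepPenaltyEq, he, B_mul_marginalPrice, abs_of_nonneg hn0, hn, max_eq_left hr,
      max_eq_right (by linarith : -r ≤ 0), sub_zero, max_eq_left (by linarith : 0 ≤ r - c),
      max_eq_right (by linarith : c - r ≤ 0)]
    field_simp
    ring
  · rw [max_eq_left (by linarith : 0 ≤ -r)] at hdr
    rw [max_eq_right hr] at hcr
    obtain rfl : c = 0 := le_antisymm hcr hc
    have hn : b.next 0 0 d = - (b.τ / (b.ηd * b.E) * d) := by simp [next]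
    have hn0 : b.next 0 0 d ≤ 0 := by
      rw [hn]; exact neg_nonpos.2 (mul_nonneg b.dischargeRate_pos.le hd)
    have he : excess (b.signalStep r) (b.next 0 0 d) = 0 := by
      refine excess_of_nonpos hn0 ?_
      rw [hn, b.signalStep_of_nonpos hr, ← mul_neg]
      exact mul_le_mul_of_nonneg_left (by linarith) b.dischargeRate_pos.le
    refine ⟨he, ?_⟩
    rw [StepPenaltyEq, he, B_mul_marginalPrice, abs_of_nonpos hn0, hn, max_eq_right hr,
      max_eq_left (by linarith : 0 ≤ -r), zero_sub, sub_neg_eq_add,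
      max_eq_right (by linarith : r + d ≤ 0), max_eq_left (by linarith : 0 ≤ -d - r)]
    field_simp
    ring

/-- If `ηc * ηd = 1`, both rates coincide and the change of SoC is a fixed multiple of the net power
`c - d`, so `deviation_eq` covers every action, including simultaneous charging and discharging. -/
theorem stepPenaltyEq_of_mul_eq_one (hη : b.ηc * b.ηd = 1) (c d r : ℝ) :
    b.StepPenaltyEq c d r := by
  have hE := b.E_pos.ne'
  have hηc := b.ηc_pos.ne'
  have hηd : b.ηd = 1 / b.ηc := by rw [eq_div_iff hηc, mul_comm]; exact hη
  set a := b.τ * b.ηc / b.E with ha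
  have ha0 : 0 < a := b.chargeRate_pos
  have ha' : b.τ / (b.ηd * b.E) = a := by rw [ha, hηd]; field_simp
  have hn : ∀ c d, b.next 0 c d = a * (c - d) := fun c d => by
    rw [next, ha', ← ha]; ring
  have hs : b.signalStep r = a * r := by
    rcases le_total 0 r with hr | hr
    · exact b.signalStep_of_nonneg hr
    · rw [b.signalStep_of_nonpos hr, ha']
  have hτ : b.τ = b.E * a / b.ηc := by rw [ha]; field_simp
  rw [StepPenaltyEq, deviation_eq, mul_assoc b.E, B_mul_marginalPrice, hs, hn,
    excess_mul ha0.le, abs_mul, abs_of_pos ha0, hηd, hτ]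
  field_simp
  ring

/-- The cost in terms of the half cycles of the profile. -/
theorem cost_eq (hzero : b.Φ 0 = 0) {x₀ : ℝ} {r : ℕ → ℝ} {T : ℕ} {a : (ℕ → ℝ) × (ℕ → ℝ)}
    (ha : ∀ t < T, b.StepPenaltyEq (a.1 t) (a.2 t) (r t)) :
    b.cost x₀ r T a = b.τ * ∑ t ∈ Finset.range T, (b.θ * max (r t) 0 + b.π * max (-r t) 0) -
      b.E * (b.θ / b.ηc - b.π * b.ηd) / 2 * (b.soc x₀ a.1 a.2 T - x₀) +
      b.E * b.B * b.marginalPrice * ∑ t ∈ Finset.range T, excess (b.signalStep (r t))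
        (b.soc x₀ a.1 a.2 (t + 1) - b.soc x₀ a.1 a.2 t) -
      b.E * b.B / 2 * ((halfCycles (extremaStack (b.soc x₀ a.1 a.2) T)).map b.saving).sum := by
  have hsum : ((halfCycles (extremaStack (b.soc x₀ a.1 a.2) T)).map b.saving).sum =
      b.marginalPrice * ∑ t ∈ Finset.range T,
        |b.soc x₀ a.1 a.2 (t + 1) - b.soc x₀ a.1 a.2 t| -
      2 * lifeLoss b.Φ ((List.range (T + 1)).map (b.soc x₀ a.1 a.2)) := by
    rw [lifeLoss_eq hzero, ← sum_swings_extremaStack, ← sum_halfCycles (zigzag_extremaStack _ _)]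
    change _ = _ - 2 * ((halfCycles (extremaStack _ _)).map _).sum
    generalize halfCycles (extremaStack (b.soc x₀ a.1 a.2) T) = U
    induction U with
    | nil => simp
    | cons u U ih =>
      simp only [List.map_cons, List.sum_cons, ih, saving]
      ring
  have hpen : b.penalty a.1 a.2 r T =
      b.τ * ∑ t ∈ Finset.range T, (b.θ * max (r t) 0 + b.π * max (-r t) 0) -
      b.E * (b.B * b.marginalPrice / 2 * ∑ t ∈ Finset.range T,
        |b.soc x₀ a.1 a.2 (t + 1) - b.soc x₀ a.1 a.2 t| +
        (b.θ / b.ηc - b.π * b.ηd) / 2 * (b.soc x₀ a.1 a.2 T - x₀)) +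
      b.E * b.B * b.marginalPrice * ∑ t ∈ Finset.range T, excess (b.signalStep (r t))
        (b.soc x₀ a.1 a.2 (t + 1) - b.soc x₀ a.1 a.2 t) := by
    have htel : b.soc x₀ a.1 a.2 T - x₀ =
        ∑ t ∈ Finset.range T, (b.soc x₀ a.1 a.2 (t + 1) - b.soc x₀ a.1 a.2 t) :=
      (Finset.sum_range_sub (b.soc x₀ a.1 a.2) T).symm
    rw [penalty, htel]
    simp only [Finset.mul_sum, ← Finset.sum_add_distrib, ← Finset.sum_sub_distrib]
    refine Finset.sum_congr rfl fun t ht => ?_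
    have hd : b.soc x₀ a.1 a.2 (t + 1) - b.soc x₀ a.1 a.2 t = b.next 0 (a.1 t) (a.2 t) :=
      b.next_sub _ _ _
    rw [hd]
    exact ha t (Finset.mem_range.1 ht)
  rw [cost, agingCost, hpen, hsum]
  ring

/-! ### Optimality -/

theorem threshold_nonneg (hprice : b.marginalPrice ∈ b.stressDeriv '' Ici 0) :
    0 ≤ b.threshold :=
  Function.invFunOn_mem hprice

theorem hasDerivWithinAt_threshold (hdiff : DifferentiableOn ℝ b.Φ (Ici 0))
    (hprice : b.marginalPrice ∈ b.stressDeriv '' Ici 0) :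
    HasDerivWithinAt b.Φ b.marginalPrice (Ici 0) b.threshold := by
  have h := (hdiff b.threshold (threshold_nonneg hprice)).hasDerivWithinAt
  have e : b.stressDeriv b.threshold = b.marginalPrice := Function.invFunOn_eq hprice
  rwa [show derivWithin b.Φ (Ici 0) b.threshold = b.marginalPrice from e] at h

theorem concaveOn_saving (hconv : ConvexOn ℝ (Ici 0) b.Φ) : ConcaveOn ℝ (Ici 0) b.saving :=
  ((concaveOn_id (convex_Ici (0 : ℝ))).smul b.marginalPrice_nonneg).sub hconv

/-- The tangent to `Φ` at the threshold has slope `marginalPrice`, and convexity keeps `Φ` above it.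
-/
theorem saving_le_threshold (hconv : ConvexOn ℝ (Ici 0) b.Φ)
    (hdiff : DifferentiableOn ℝ b.Φ (Ici 0))
    (hprice : b.marginalPrice ∈ b.stressDeriv '' Ici 0) {u : ℝ} (hu : 0 ≤ u) :
    b.saving u ≤ b.saving b.threshold := by
  have hd := hasDerivWithinAt_threshold hdiff hprice
  have hû := threshold_nonneg hprice
  simp only [saving]
  rcases lt_trichotomy u b.threshold with h | h | h
  · have := hconv.slope_le_of_hasDerivWithinAt hu hû h hd
    rw [slope_def_field, div_le_iff₀ (sub_pos.2 h)] at this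
    linarith
  · rw [h]
  · have := hconv.le_slope_of_hasDerivWithinAt hû hu h hd
    rw [slope_def_field, le_div_iff₀ (sub_pos.2 h)] at this
    linarith

theorem monotoneOn_saving (hconv : ConvexOn ℝ (Ici 0) b.Φ)
    (hdiff : DifferentiableOn ℝ b.Φ (Ici 0))
    (hprice : b.marginalPrice ∈ b.stressDeriv '' Ici 0) :
    MonotoneOn b.saving (Icc 0 b.threshold) := by
  intro p hp q hq hpq
  have hû := threshold_nonneg hprice
  have := (concaveOn_saving hconv).min_le_of_mem_Icc hp.1 hû ⟨hpq, hq.2⟩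
  rwa [min_eq_left (saving_le_threshold hconv hdiff hprice hp.1)] at this

/-- The half cycles of any profile save at most a constant more than those of the policy, up to
the excess over the signal. -/
theorem sum_saving_le (hconv : ConvexOn ℝ (Ici 0) b.Φ)
    (hdiff : DifferentiableOn ℝ b.Φ (Ici 0)) (hmono : MonotoneOn b.Φ (Ici 0)) (hzero : b.Φ 0 = 0)
    (hprice : b.marginalPrice ∈ b.stressDeriv '' Ici 0) {x₀ : ℝ}
    (hx₀ : x₀ ∈ Icc b.xlo b.xhi) (r x : ℕ → ℝ) (T : ℕ) (hx : ∀ t ≤ T, x t ∈ Icc b.xlo b.xhi) :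
    ((halfCycles (extremaStack x T)).map b.saving).sum ≤
      ((halfCycles (extremaStack (fun t => (b.controller x₀ r t).x) T)).map b.saving).sum +
        b.marginalPrice * (b.threshold +
          2 * ∑ t ∈ Finset.range T, excess (b.signalStep (r t)) (x (t + 1) - x t)) := by
  have hû := threshold_nonneg hprice
  have hW : 0 ≤ b.xhi - b.xlo := sub_nonneg.2 (hx₀.1.trans hx₀.2)
  have hadm := admissible_controller hû hx₀ r
  have hU : ∀ u ∈ halfCycles (extremaStack x T), 0 ≤ u ∧ u ≤ b.xhi - b.xlo :=
    halfCycles_mem_Icc fun a ha => by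
      obtain ⟨t, ht, rfl⟩ := exists_of_mem_extremaStack ha
      exact hx t ht
  have hV : ∀ u ∈ halfCycles (extremaStack (fun t => (b.controller x₀ r t).x) T),
      0 ≤ u ∧ u ≤ (b.controller x₀ r T).xmax - (b.controller x₀ r T).xmin :=
    halfCycles_mem_Icc fun a ha => by
      obtain ⟨t, ht, rfl⟩ := exists_of_mem_extremaStack ha
      exact ⟨(xmin_controller_antitone r ht).trans (hadm t).min_le,
        (hadm t).le_max.trans (xmax_controller_monotone r ht)⟩
  set U := halfCycles (extremaStack x T)
  set V := halfCycles (extremaStack (fun t => (b.controller x₀ r t).x) T)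
  set H := min b.threshold (b.xhi - b.xlo) with hH
  have hH0 : 0 ≤ H := le_min hû hW
  -- If `H` is the threshold, cutting a deeper cycle moves it to the maximum of `saving`; if `H =
  -- xhi - xlo`, no cycle is deeper.
  have htrunc : (U.map b.saving).sum ≤ ((U.map fun u => min u H).map b.saving).sum := by
    rw [List.map_map]
    refine List.sum_le_sum fun u hu => ?_
    obtain ⟨u0, uW⟩ := hU u hu
    rcases le_total u H with k | k
    · simp [min_eq_left k]
    · simp only [Function.comp_apply, min_eq_right k]
      rcases min_cases b.threshold (b.xhi - b.xlo) with ⟨e, _⟩ | ⟨e, _⟩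
      · rw [hH, e]
        exact saving_le_threshold hconv hdiff hprice u0
      · rw [← hH] at e
        rw [le_antisymm (e ▸ uW) k]
  refine htrunc.trans (sum_map_le_of_sum_min_le (H := H) (concaveOn_saving hconv)
    (by simp [saving, hzero]) b.marginalPrice_nonneg ?_ ?_
    ((monotoneOn_saving hconv hdiff hprice).mono (Icc_subset_Icc_right (min_le_left _ _))) ?_ ?_ ?_)
  · exact add_nonneg hû (mul_nonneg zero_le_two (Finset.sum_nonneg fun _ _ => le_max_left _ _))
  · intro p hp
    have := hmono self_mem_Ici hp hp
    simp only [saving]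
    linarith
  · intro u hu
    obtain ⟨v, hv, rfl⟩ := List.mem_map.1 hu
    exact ⟨le_min (hU v hv).1 hH0, min_le_right _ _⟩
  -- The policy's half cycles need no truncation: its SoC range never exceeds the threshold.
  · intro u hu
    have := hadm T
    exact ⟨(hV u hu).1, (hV u hu).2.trans (le_min this.range_le
      (by linarith [this.lo_le, this.le_hi]))⟩
  · rintro h ⟨h0, hhH⟩
    have hhû : h ≤ b.threshold := hhH.trans (min_le_left _ _)
    have hhW : h ≤ b.xhi - b.xlo := hhH.trans (min_le_right _ _)
    have hσ : max 0 (h - (b.xhi - x₀)) ∈ Icc 0 h :=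
      ⟨le_max_left _ _, max_le h0 (by linarith [hx₀.2])⟩
    have key := sum_min_halfCycles_le_of_greedy hσ x (fun t => (b.controller x₀ r t).x)
      (fun t => b.signalStep (r t)) T
      (fun t _ => greedy_controller hû hx₀ h0 hhW hhû r rfl t)
    rw [List.map_map]
    have e : ((fun u => min u h) ∘ fun u => min u H) = fun u => min u h := by
      funext u
      simp only [Function.comp_apply, min_assoc, min_eq_right hhH]
    rw [e]
    linarith

/-- The regret of the policy against operable actions whose penalties are accounted for by the
half cycles. -/
theorem onlineCost_le (hconv : ConvexOn ℝ (Ici 0) b.Φ)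
    (hdiff : DifferentiableOn ℝ b.Φ (Ici 0)) (hmono : MonotoneOn b.Φ (Ici 0)) (hzero : b.Φ 0 = 0)
    (hprice : b.marginalPrice ∈ b.stressDeriv '' Ici 0) {x₀ : ℝ}
    (hx₀ : x₀ ∈ Icc b.xlo b.xhi) {r : ℕ → ℝ} {T : ℕ} (hr : ∀ t < T, r t ∈ Icc (-b.P) b.P)
    {a : (ℕ → ℝ) × (ℕ → ℝ)} (ha : a ∈ b.operable x₀ T)
    (hpen : ∀ t < T, b.StepPenaltyEq (a.1 t) (a.2 t) (r t)) :
    b.onlineCost x₀ r T - b.cost x₀ r T a ≤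
      b.E * b.B / 2 * (b.marginalPrice * b.threshold) +
        b.E * |b.θ / b.ηc - b.π * b.ηd| / 2 * (b.xhi - b.xlo) := by
  have hû := threshold_nonneg hprice
  have hon := onlineActions_mem hû hx₀ hr
  have hg : ∀ t < T, excess (b.signalStep (r t)) (b.next 0 ((b.onlineActions x₀ r).1 t)
      ((b.onlineActions x₀ r).2 t)) = 0 ∧
      b.StepPenaltyEq ((b.onlineActions x₀ r).1 t) ((b.onlineActions x₀ r).2 t) (r t) :=
    fun t ht => excess_eq_zero_and_stepPenaltyEq (hon.1 t ht).1.1 (hon.1 t ht).2.1.1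
      (hon.2 t ht).1 (hon.2 t ht).2
  have hx : ∀ c : (ℕ → ℝ) × (ℕ → ℝ), c ∈ b.operable x₀ T → ∀ t ≤ T,
      b.soc x₀ c.1 c.2 t ∈ Icc b.xlo b.xhi := by
    intro c hc t ht
    cases t with
    | zero => exact hx₀
    | succ t => exact (hc t (by omega)).2.2
  have hexc : ∑ t ∈ Finset.range T, excess (b.signalStep (r t))
      (b.soc x₀ (b.onlineActions x₀ r).1 (b.onlineActions x₀ r).2 (t + 1) -
        b.soc x₀ (b.onlineActions x₀ r).1 (b.onlineActions x₀ r).2 t) = 0 := by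
    refine Finset.sum_eq_zero fun t ht => ?_
    rw [soc, next_sub]
    exact (hg t (Finset.mem_range.1 ht)).1
  have hsav := sum_saving_le hconv hdiff hmono hzero hprice hx₀ r (b.soc x₀ a.1 a.2) T (hx a ha)
  rw [← funext (b.soc_onlineActions x₀ r)] at hsav
  rw [onlineCost, cost_eq hzero fun t ht => (hg t ht).2, cost_eq hzero hpen, hexc]
  have hxa := hx a ha T le_rfl
  have hxg := hx _ hon.1 T le_rfl
  set xa := b.soc x₀ a.1 a.2 T
  set xg := b.soc x₀ (b.onlineActions x₀ r).1 (b.onlineActions x₀ r).2 T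
  -- The only other loss is the difference of the final SoCs, bounded by the width of the SoC
  -- window.
  have hend : (b.θ / b.ηc - b.π * b.ηd) * (xa - xg) ≤
      |b.θ / b.ηc - b.π * b.ηd| * (b.xhi - b.xlo) := by
    refine (le_abs_self _).trans ?_
    rw [abs_mul]
    refine mul_le_mul_of_nonneg_left (abs_le.2 ⟨?_, ?_⟩) (abs_nonneg _) <;>
      linarith [hxa.1, hxa.2, hxg.1, hxg.2]
  have h1 := mul_le_mul_of_nonneg_left hend (div_nonneg b.E_pos.le zero_le_two)
  -- After scaling by `E * B / 2`, the gain from exceeding the signal is `E * B * marginalPrice`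
  -- times the total excess, which cancels the excess charge in the competitor's cost.
  have h2 := mul_le_mul_of_nonneg_left hsav
    (div_nonneg (mul_pos b.E_pos b.B_pos).le zero_le_two)
  linarith

end Battery

end CycleAging
end

/-! ### The regret bound -/

theorem theorem2 (b : CycleAging.Battery)
    (hconv : StrictConvexOn ℝ (Set.Ici 0) b.Φ)
    (hdiff : DifferentiableOn ℝ b.Φ (Set.Ici 0))
    (hmono : MonotoneOn b.Φ (Set.Ici 0))
    (hzero : b.Φ 0 = 0)
    (hprice : b.marginalPrice ∈ b.stressDeriv '' Set.Ici 0) :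
    ∃ ε : ℝ, ∀ (T : ℕ) (x₀ : ℝ) (r : ℕ → ℝ),
      x₀ ∈ Set.Icc b.xlo b.xhi →
      (∀ t < T, r t ∈ Set.Icc (-b.P) b.P) →
        b.onlineActions x₀ r ∈
            b.operable x₀ T ∩ CycleAging.Battery.withinSignal r T ∧
        b.onlineCost x₀ r T - b.offlineOpt x₀ r T ≤ ε ∧
        (b.ηc * b.ηd = 1 → b.onlineCost x₀ r T - b.offlineOptFree x₀ r T ≤ ε) := by
  -- The first term comes from the stop-operator error, at most the threshold for every width; the
  -- second from the final SoCs.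
  refine ⟨b.E * b.B / 2 * (b.marginalPrice * b.threshold) +
    b.E * |b.θ / b.ηc - b.π * b.ηd| / 2 * (b.xhi - b.xlo), fun T x₀ r hx₀ hr => ?_⟩
  have hon := CycleAging.Battery.onlineActions_mem
    (CycleAging.Battery.threshold_nonneg hprice) hx₀ hr
  refine ⟨hon, ?_, fun hη => ?_⟩
  · rw [sub_le_comm]
    -- The policy's own actions show that the set of costs is nonempty.
    refine le_csInf ⟨_, Set.mem_image_of_mem _ hon⟩ ?_
    rintro _ ⟨a, ha, rfl⟩
    rw [sub_le_comm]
    exact CycleAging.Battery.onlineCost_le hconv.convexOn hdiff hmono hzero hprice hx₀ hr ha.1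
      fun t ht => (CycleAging.Battery.excess_eq_zero_and_stepPenaltyEq (ha.1 t ht).1.1
        (ha.1 t ht).2.1.1 (ha.2 t ht).1 (ha.2 t ht).2).2
  · rw [sub_le_comm]
    refine le_csInf ⟨_, Set.mem_image_of_mem _ hon.1⟩ ?_
    rintro _ ⟨a, ha, rfl⟩
    rw [sub_le_comm]
    exact CycleAging.Battery.onlineCost_le hconv.convexOn hdiff hmono hzero hprice hx₀ hr ha
      fun t _ => CycleAging.Battery.stepPenaltyEq_of_mul_eq_one hη _ _ _
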